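/- For a finite group $G$ let $C(G)$ be the poset of cyclic subgroups of $G$ and put $\alpha(G)=|C(G)|/|G|$. Write $C_m$ for the cyclic group of order $m$, let $$M(p^n)=\langle x,y \mid x^{p^{n-1}}=y^p=1,\ y^{-1}xy=x^{1+p^{n-2}}\rangle ,$$ and let $Q_{2^n}=\langle x,y\mid x^{2^{n-1}}=1,\ y^2=x^{2^{n-2}},\ yxy^{-1}=x^{-1}\rangle$ be the generalized quaternion group of order $2^n$. Theorem. Let $p$ be a prime, $n\geq 3$ an integer, and let $G$ be a group of order $p^n$ with $G\not\cong C_{p^n}$. (i) If $p$ is odd, then $\alpha(G)\geq \alpha(C_p\times C_{p^{n-1}})=\alpha(M(p^n))$, with equality if and only if $G\cong C_p\times C_{p^{n-1}}$ or $G\cong M(p^n)$. (ii) If $p=2$, then: - for $n=3$, $\alpha(G)\geq\alpha(Q_8)$, with equality if and only if $G\cong Q_8$; - for $n=4$, $\alpha(G)\geq\alpha(C_2\times C_8)=\alpha(M(16))=\alpha(Q_{16})$, with equality if and only if $G$ is isomorphic to $C_2\times C_8$, $M(16)$ or $Q_{16}$; - for $n\geq 5$, $\alpha(G)\geq\alpha(C_2\times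 C_{2^{n-1}})=\alpha(M(2^n))$, with equality if and only if $G\cong C_2\times C_{2^{n-1}}$ or $G\cong M(2^n)$. In each case the groups listed as minimum points are themselves non-cyclic of order $p^n$, and the minimum is strictly larger than $\alpha(C_{p^n})$, so that it is the second minimum value of $\alpha$ on the groups of order $p^n$. -/

import Mathlib

universe u

/-- The set `C(G)` of cyclic subgroups of a group `G` (ordered by inclusion, as a set of
subgroups). -/
def cyclicSubgroups (G : Type*) [Group G] : Set (Subgroup G) :=
  {H | IsCyclic H}

/-- The ratio `α(G) = |C(G)| / |G|`; meaningful for finite groups `G`, to which it is applied. -/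
noncomputable def alphaRatio (G : Type*) [Group G] : ℚ :=
  (Nat.card (cyclicSubgroups G) : ℚ) / (Nat.card G : ℚ)

/-- The cyclic group `C_m` of order `m` (for `m ≥ 1`), written multiplicatively. -/
abbrev CyclicGrp (m : ℕ) : Type := Multiplicative (ZMod m)

/-- The relators of the modular `p`-group on the generators `x = of 0`, `y = of 1`:
`x ^ (p ^ (n - 1)) = 1`, `y ^ p = 1` and `y⁻¹ x y = x ^ (1 + p ^ (n - 2))`. -/
def modularRels (p n : ℕ) : Set (FreeGroup (Fin 2)) :=
  let x : FreeGroup (Fin 2) := FreeGroup.of 0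
  let y : FreeGroup (Fin 2) := FreeGroup.of 1
  {x ^ p ^ (n - 1), y ^ p, y⁻¹ * x * y * (x ^ (1 + p ^ (n - 2)))⁻¹}

/-- The modular `p`-group
`M(p^n) = ⟨x, y | x ^ (p ^ (n - 1)) = y ^ p = 1, y⁻¹ x y = x ^ (1 + p ^ (n - 2))⟩`. -/
abbrev ModularPGroup (p n : ℕ) : Type := PresentedGroup (modularRels p n)

/-- `G` is a group of order `p ^ n` that is not isomorphic to the cyclic group `C_{p^n}`. -/
def IsNonCyclicOfOrder (p n : ℕ) (G : Type*) [Group G] : Prop :=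
  Nat.card G = p ^ n ∧ ¬ Nonempty (G ≃* CyclicGrp (p ^ n))

open Subgroup
open scoped Pointwise

/-! Since the order is fixed, comparing `α` means comparing numbers of cyclic subgroups. Giving each
element `g` the weight `1/φ(o(g))` turns that number into a sum over `G`, because a cyclic subgroup
of order `d` has `φ(d)` generators. Write `|G| = p^(m+1)` with `G` noncyclic; the target value is `2
+ mp`.

Suppose some `x` has order `p^m`, so that `⟨x⟩` is normal of index `p`. If an outside element acts
on `⟨x⟩` by an exponent `r ≡ 1` (mod `p`, and mod `4` when `p = 2`), a correction inside its coset
makes the extension split. The count is then exactly `2 + mp`, and `G` is `C_p × C_{p^m}` or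
`M(p^(m+1))`. Otherwise `p = 2` and every outside element acts by `r ≡ 3` mod `4`; outside elements
then have order at most `4`, and the count is at least `m + 1 + 2^(m-1)`, with equality only for the
generalized quaternion group. This number is below `2 + 2m` for `m = 2`, equal to it for `m = 3` and
larger afterwards, which explains the exceptional orders `8` and `16`.

Suppose no element has order `p^m`. Then `2 + mp` is exceeded, by induction through `G/Z` with `Z`
central of order `p` (`lt_card_cyclicSubgroups_succ`). Passing from `G/Z` up to `G` gains one cyclic
subgroup from `Z`, and `p - 1` more for each nontrivial cyclic subgroup of `G/Z` whose generators
lift without increase of order. A second subgroup of order `p` supplies one of these; it exists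
because a `p`-group with only one has a cyclic subgroup of index at most `p`
(`exists_pow_dvd_orderOf_of_unique_subgroup`). -/

/-! ### Counting cyclic subgroups as a weighted sum over elements. -/

theorem card_filter_zpowers_eq {G : Type*} [Group G] [Fintype G]
    (g₀ : G) [DecidablePred fun g : G => zpowers g = zpowers g₀] :
    (Finset.univ.filter fun g : G => zpowers g = zpowers g₀).card = (orderOf g₀).totient := by
  classical
  have hc : orderOf g₀ ∣ Fintype.card (zpowers g₀) := by
    rw [Fintype.card_zpowers]
  rw [← IsCyclic.card_orderOf_eq_totient (α := zpowers g₀) hc]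
  symm
  refine Finset.card_bij (fun a _ => (a : G)) ?_ ?_ ?_
  · intro a ha
    simp only [Finset.mem_filter, Finset.mem_univ, true_and] at ha ⊢
    refine Subgroup.eq_of_le_of_card_ge ((zpowers_le).2 a.2) ?_
    rw [Nat.card_zpowers, Nat.card_zpowers, ← ha, Subgroup.orderOf_coe]
  · intro a _ b _ h
    exact Subtype.ext h
  · intro b hb
    simp only [Finset.mem_filter, Finset.mem_univ, true_and] at hb
    refine ⟨⟨b, hb ▸ mem_zpowers b⟩, ?_, rfl⟩
    simp only [Finset.mem_filter, Finset.mem_univ, true_and]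
    rw [← Subgroup.orderOf_coe, ← Nat.card_zpowers, hb, Nat.card_zpowers]

theorem totient_orderOf_pos {G : Type*} [Group G] [Finite G] (g : G) :
    (0 : ℚ) < ((orderOf g).totient : ℚ) := by
  exact_mod_cast Nat.totient_pos.2 (orderOf_pos g)

/-- The fibre of `g ↦ zpowers g` over a cyclic subgroup is its set of generators, whose weights add
up to `1`. -/
theorem card_cyclicSubgroups_eq_sum (G : Type*) [Group G] [Fintype G] :
    (Nat.card (cyclicSubgroups G) : ℚ) = ∑ g : G, ((orderOf g).totient : ℚ)⁻¹ := by
  classical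
  let f : G → cyclicSubgroups G := fun g => ⟨zpowers g, by
    show IsCyclic (zpowers g); infer_instance⟩
  rw [← Finset.sum_fiberwise (s := Finset.univ) (g := f), Nat.card_eq_fintype_card]
  have : ∀ H : cyclicSubgroups G,
      ∑ g : G with f g = H, ((orderOf g).totient : ℚ)⁻¹ = 1 := by
    rintro ⟨H, hH⟩
    obtain ⟨g₀, rfl⟩ := (Subgroup.isCyclic_iff_exists_zpowers_eq_top H).1 hH
    have h1 : ∀ g ∈ Finset.univ.filter (fun g : G => f g = ⟨zpowers g₀, hH⟩),
        ((orderOf g).totient : ℚ)⁻¹ = ((orderOf g₀).totient : ℚ)⁻¹ := by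
      intro g hg
      simp only [Finset.mem_filter, Finset.mem_univ, true_and, f, Subtype.mk.injEq] at hg
      rw [← Nat.card_zpowers, hg, Nat.card_zpowers]
    rw [Finset.sum_congr rfl h1, Finset.sum_const, nsmul_eq_mul]
    have h2 := card_filter_zpowers_eq g₀
    simp only [f, Subtype.mk.injEq, h2]
    exact mul_inv_cancel₀ (totient_orderOf_pos g₀).ne'
  simp [this]

theorem card_cyclicSubgroups_congr {G H : Type*} [Group G] [Group H] (e : G ≃* H) :
    Nat.card (cyclicSubgroups G) = Nat.card (cyclicSubgroups H) := by
  refine Nat.card_congr ((e.mapSubgroup.toEquiv).subtypeEquiv fun K => ?_)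
  exact (e.subgroupMap K).isCyclic

theorem alphaRatio_congr {G H : Type*} [Group G] [Group H] (e : G ≃* H) :
    alphaRatio G = alphaRatio H := by
  rw [alphaRatio, alphaRatio, card_cyclicSubgroups_congr e, Nat.card_congr e.toEquiv]

theorem orderOf_eq_prime_pow_of_pow_eq_one {G : Type*} [Group G] {p : ℕ} (hp : p.Prime) {k : ℕ}
    {g : G} (h : g ^ p ^ k = 1) : ∃ i ≤ k, orderOf g = p ^ i :=
  (Nat.dvd_prime_pow hp).1 (orderOf_dvd_of_pow_eq_one h)

theorem pow_card_prime_pow {G : Type*} [Group G] {p n : ℕ} (hG : Nat.card G = p ^ n) (g : G) :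
    g ^ p ^ n = 1 := by
  rw [← hG, pow_card_eq_one']

/-- Bounded exponent makes every weight large. This crude bound is enough for the base cases of the
induction. -/
theorem one_add_le_card_cyclicSubgroups {G : Type*} [Group G] [Fintype G] {p e : ℕ} (hp : p.Prime)
    (h : ∀ g : G, g ^ p ^ e = 1) :
    1 + ((Nat.card G : ℚ) - 1) / ((p ^ e).totient : ℚ) ≤ Nat.card (cyclicSubgroups G) := by
  classical
  rw [card_cyclicSubgroups_eq_sum, ← Finset.add_sum_erase _ _ (Finset.mem_univ (1 : G))]
  simp only [orderOf_one, Nat.totient_one, Nat.cast_one, inv_one]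
  have : ∑ g ∈ Finset.univ.erase (1 : G), ((p ^ e).totient : ℚ)⁻¹ ≤
      ∑ g ∈ Finset.univ.erase (1 : G), ((orderOf g).totient : ℚ)⁻¹ := by
    refine Finset.sum_le_sum fun g _ => ?_
    refine inv_anti₀ (totient_orderOf_pos g) ?_
    exact_mod_cast Nat.le_of_dvd (Nat.totient_pos.2 (pow_pos hp.pos _))
      (Nat.totient_dvd_of_dvd (orderOf_dvd_of_pow_eq_one (h g)))
  rw [Finset.sum_const, Finset.card_erase_of_mem (Finset.mem_univ _), Finset.card_univ,
    nsmul_eq_mul, Nat.cast_pred Fintype.card_pos, ← Nat.card_eq_fintype_card] at this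
  rw [div_eq_mul_inv]
  linarith

theorem card_cyclicSubgroups_of_isCyclic {G : Type*} [Group G] [Finite G] [IsCyclic G] :
    Nat.card (cyclicSubgroups G) = (Nat.card G).divisors.card := by
  classical
  have := Fintype.ofFinite G
  have h : (Nat.card (cyclicSubgroups G) : ℚ) = (Nat.card G).divisors.card := by
    rw [card_cyclicSubgroups_eq_sum]
    rw [← Finset.sum_fiberwise_of_maps_to (t := (Nat.card G).divisors) (g := fun g : G => orderOf g)]
    · rw [Finset.card_eq_sum_ones, Nat.cast_sum]
      refine Finset.sum_congr rfl fun d hd => ?_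
      have h1 : ∀ g ∈ Finset.univ.filter (fun g : G => orderOf g = d),
          ((orderOf g).totient : ℚ)⁻¹ = (d.totient : ℚ)⁻¹ := by
        intro g hg
        simp only [Finset.mem_filter, Finset.mem_univ, true_and] at hg
        rw [hg]
      have hd' := Nat.dvd_of_mem_divisors hd
      rw [Finset.sum_congr rfl h1, Finset.sum_const, nsmul_eq_mul,
        IsCyclic.card_orderOf_eq_totient (by rwa [← Nat.card_eq_fintype_card]), Nat.cast_one]
      refine mul_inv_cancel₀ ?_
      exact_mod_cast (Nat.totient_pos.2 (Nat.pos_of_mem_divisors hd)).ne'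
    · intro g _
      exact Nat.mem_divisors.2 ⟨orderOf_dvd_natCard g, Nat.card_pos.ne'⟩
  exact_mod_cast h

/-! ### Elements acting on a cyclic subgroup by a power. -/

/-- This sum is the exponent by which `x ^ i` contributes to `(x ^ i * y) ^ p`. For odd `p` it is
`p` modulo `p^2`; for `p = 2` it is `1 + r`, which is twice an odd number only when `r ≡ 1` mod `4`.
All the mod `4` conditions below come from here. -/
theorem exists_geom_sum_eq_prime_mul {p r : ℕ} (hp : p.Prime) (hr : r ≡ 1 [MOD p])
    (hr' : p = 2 → r ≡ 1 [MOD 4]) :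
    ∃ u, ∑ j ∈ Finset.range p, r ^ j = p * u ∧ ¬ p ∣ u := by
  rcases hp.eq_two_or_odd' with rfl | hodd
  · have h := hr' rfl
    refine ⟨(r + 1) / 2, ?_, ?_⟩
    · simp only [Finset.sum_range_succ, Finset.sum_range_zero, pow_zero, pow_one]
      unfold Nat.ModEq at h
      omega
    · unfold Nat.ModEq at h
      omega
  · have h1 : (p : ℤ) ∣ (r : ℤ) - 1 := by
      have := (Nat.modEq_iff_dvd.1 hr.symm)
      simpa using this
    obtain ⟨b, hb⟩ := h1
    have h2 := odd_sq_dvd_geom_sum₂_sub (R := ℤ) (1 : ℤ) b hodd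
    have hb' : 1 + (p : ℤ) * b = r := by linarith
    simp only [hb', one_pow, mul_one] at h2
    obtain ⟨c, hc⟩ := h2
    have h3 : (p : ℤ) ∣ ((∑ j ∈ Finset.range p, r ^ j : ℕ) : ℤ) := by
      push_cast
      exact ⟨1 + p * c, by linear_combination hc⟩
    obtain ⟨u, hu⟩ := Int.natCast_dvd_natCast.1 h3
    refine ⟨u, hu, fun hpu => ?_⟩
    obtain ⟨v, rfl⟩ := hpu
    have h4 : (p : ℤ) * (p * v) = p * (1 + p * c) := by
      have : ((∑ j ∈ Finset.range p, r ^ j : ℕ) : ℤ) = ((p * (p * v) : ℕ) : ℤ) := by rw [hu]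
      push_cast at this
      linear_combination hc - this
    have hp0 : (p : ℤ) ≠ 0 := by exact_mod_cast hp.ne_zero
    have h5 := mul_left_cancel₀ hp0 h4
    have h6 : (p : ℤ) ∣ 1 := ⟨v - c, by linear_combination -h5⟩
    have := Int.natCast_dvd_natCast.1 (by simpa using h6 : (p : ℤ) ∣ ((1 : ℕ) : ℤ))
    exact hp.one_lt.ne' (Nat.dvd_one.1 this)

section Conj

variable {G : Type*} [Group G] {x y : G} {r : ℕ}

theorem mul_pow_eq_of_conj (h : y * x * y⁻¹ = x ^ r) (i : ℕ) : y * x ^ i = x ^ (r * i) * y := by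
  rw [pow_mul, ← h, conj_pow]; group

theorem conj_pow_pow (h : y * x * y⁻¹ = x ^ r) (k : ℕ) :
    y ^ k * x * (y ^ k)⁻¹ = x ^ r ^ k := by
  induction k with
  | zero => simp
  | succ k ih =>
    have h1 : y ^ (k + 1) * x * (y ^ (k + 1))⁻¹ = y * (y ^ k * x * (y ^ k)⁻¹) * y⁻¹ := by
      rw [pow_succ']; group
    rw [h1, ih, ← conj_pow, h, ← pow_mul, pow_succ']

theorem pow_mul_pow_of_conj (h : y * x * y⁻¹ = x ^ r) (i k : ℕ) :
    (x ^ i * y) ^ k = x ^ (i * ∑ j ∈ Finset.range k, r ^ j) * y ^ k := by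
  induction k with
  | zero => simp
  | succ k ih =>
    rw [pow_succ', ih, geom_sum_succ, mul_assoc, ← mul_assoc y, mul_pow_eq_of_conj h, mul_assoc,
      ← mul_assoc, ← pow_add, ← pow_succ']
    congr 2
    ring

theorem exists_conj_eq_pow [Finite G] (hn : (zpowers x).Normal) (y : G) :
    ∃ r : ℕ, y * x * y⁻¹ = x ^ r := by
  have := hn.conj_mem x (mem_zpowers x) y
  obtain ⟨r, hr⟩ := mem_powers_iff_mem_zpowers.2 this
  exact ⟨r, hr.symm⟩

/-- In an extension of `⟨x⟩` by an element acting as a power congruent to `1`, a `p`-th power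
`y ^ p ∈ ⟨x ^ p⟩` can be corrected to be trivial. -/
theorem exists_pow_mul_pow_prime_eq_one {p m b : ℕ} (hp : p.Prime) (hx : x ^ p ^ m = 1)
    (h : y * x * y⁻¹ = x ^ r) (hr : r ≡ 1 [MOD p]) (hr' : p = 2 → r ≡ 1 [MOD 4])
    (hy : y ^ p = x ^ (p * b)) : ∃ i : ℕ, (x ^ i * y) ^ p = 1 := by
  obtain ⟨u, hu, hpu⟩ := exists_geom_sum_eq_prime_mul hp hr hr'
  have : NeZero (p ^ m) := ⟨(pow_pos hp.pos m).ne'⟩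
  have hcop : u.Coprime (p ^ m) := Nat.Coprime.pow_right m ((hp.coprime_iff_not_dvd.2 hpu).symm)
  -- The `p`-th power of `x ^ i * y` is `x ^ (p * (i * u + b))`, and `u` is invertible modulo `p ^
  -- m`.
  have hi : ∃ i : ℕ, p ^ m ∣ i * u + b := by
    refine ⟨(-(b : ZMod (p ^ m)) * (u : ZMod (p ^ m))⁻¹).val, ?_⟩
    rw [← ZMod.natCast_eq_zero_iff]
    push_cast
    rw [ZMod.natCast_zmod_val, mul_assoc, mul_comm (_⁻¹), ZMod.coe_mul_inv_eq_one u hcop]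
    ring
  obtain ⟨i, c, hc⟩ := hi
  refine ⟨i, ?_⟩
  rw [pow_mul_pow_of_conj h, hu, hy, ← pow_add,
    show i * (p * u) + p * b = p ^ m * (c * p) by linear_combination p * hc, pow_mul, hx, one_pow]

/-- `y ^ p` is a power of `x`, hence commutes with it, while it acts by the exponent `r ^ p`. -/
theorem modEq_of_conj_of_pow_mem {p m : ℕ} (hx : orderOf x = p ^ m)
    (h : y * x * y⁻¹ = x ^ r) (hy : y ^ p ∈ zpowers x) : r ^ p ≡ 1 [MOD p ^ m] := by
  have h1 := conj_pow_pow h p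
  obtain ⟨j, hj⟩ := hy
  have h2 : y ^ p * x * (y ^ p)⁻¹ = x := by
    rw [← hj]; group
  rw [h2] at h1
  rw [← hx]
  refine pow_eq_pow_iff_modEq.1 ?_
  rw [← h1, pow_one]

theorem modEq_one_of_conj_of_pow_mem {p m : ℕ} (hp : p.Prime) (hm : m ≠ 0) (hx : orderOf x = p ^ m)
    (h : y * x * y⁻¹ = x ^ r) (hy : y ^ p ∈ zpowers x) : r ≡ 1 [MOD p] := by
  have h1 := (modEq_of_conj_of_pow_mem hx h hy).of_dvd (dvd_pow_self p hm)
  have : Fact p.Prime := ⟨hp⟩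
  rw [← ZMod.natCast_eq_natCast_iff] at h1 ⊢
  rw [← h1]; push_cast
  rw [ZMod.pow_card]

theorem mem_zpowers_of_pow_eq_pow {p m a : ℕ} (hp : p.Prime) (hx : orderOf x = p ^ m)
    (hy : y ^ p = x ^ a) (ha : ¬ p ∣ a) : x ∈ zpowers y := by
  have hcop : (orderOf x).Coprime a := by
    rw [hx]; exact Nat.Coprime.pow_left m (hp.coprime_iff_not_dvd.2 ha)
  obtain ⟨k, hk⟩ := exists_pow_eq_self_of_coprime hcop.symm
  rw [← hk, ← hy, ← pow_mul]
  exact pow_mem (mem_zpowers y) _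

/-- If `y` normalizes a cyclic `p`-subgroup `⟨x⟩` and `y ^ p ∈ ⟨x⟩`, then, under the congruence
condition on the action, either `⟨x, y⟩ = ⟨y⟩` or the coset of `y` contains a `p`-torsion element. -/
theorem mem_zpowers_or_exists_pow_eq_one [Finite G] {p m : ℕ} (hp : p.Prime) (hm : m ≠ 0)
    (hx : orderOf x = p ^ m) (h : y * x * y⁻¹ = x ^ r) (hy : y ^ p ∈ zpowers x)
    (hr' : p = 2 → r ≡ 1 [MOD 4]) : x ∈ zpowers y ∨ ∃ i : ℕ, (x ^ i * y) ^ p = 1 := by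
  have hr := modEq_one_of_conj_of_pow_mem hp hm hx h hy
  obtain ⟨a, ha⟩ := mem_powers_iff_mem_zpowers.2 hy
  by_cases hpa : p ∣ a
  · obtain ⟨b, rfl⟩ := hpa
    exact .inr (exists_pow_mul_pow_prime_eq_one hp (hx ▸ pow_orderOf_eq_one x) h hr hr' ha.symm)
  · exact .inl (mem_zpowers_of_pow_eq_pow hp hx ha.symm hpa)

end Conj

/-! ### p-groups with a unique subgroup of order p. -/

section UniqueSubgroup

variable {G : Type*} [Group G] {p : ℕ}

theorem exists_pow_prime_mem_of_not_mem (hG : IsPGroup p G) {H : Subgroup G} {y : G}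
    (hy : y ∉ H) : ∃ k, y ^ p ^ k ∉ H ∧ (y ^ p ^ k) ^ p ∈ H := by
  classical
  have hex : ∃ k, y ^ p ^ k ∈ H := by
    obtain ⟨k, hk⟩ := hG y
    exact ⟨k, hk ▸ H.one_mem⟩
  obtain ⟨k, hk⟩ : ∃ k, Nat.find hex = k + 1 := by
    refine Nat.exists_eq_succ_of_ne_zero fun h0 => hy ?_
    have := Nat.find_spec hex
    rwa [h0, pow_zero, pow_one] at this
  refine ⟨k, Nat.find_min hex (by omega), ?_⟩
  have := Nat.find_spec hex
  rwa [hk, pow_succ, pow_mul] at this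

variable [Finite G]

/-- Take `x` of maximal order with `u ∈ ⟨x⟩`. If `⟨x⟩` is proper, its normalizer is larger and
contains an outside `y` with `y ^ p ∈ ⟨x⟩`. Then either `⟨y⟩` contains `x` and contradicts
maximality, or the coset of `y` contains a second subgroup of order `p`. For `p = 2` the central
element of order `4` excludes the quaternion groups. -/
theorem isCyclic_of_unique_subgroup_of_order_prime (hp : p.Prime) (hG : IsPGroup p G)
    (huniq : ∀ s t : G, orderOf s = p → orderOf t = p → t ∈ zpowers s)
    (h4 : p = 2 → ∃ u ∈ center G, orderOf u = 4) : IsCyclic G := by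
  classical
  have : Fact p.Prime := ⟨hp⟩
  obtain ⟨u, hu, hu4⟩ : ∃ u ∈ center G, p = 2 → orderOf u = 4 := by
    by_cases h : p = 2
    · obtain ⟨u, hu, hu4⟩ := h4 h
      exact ⟨u, hu, fun _ => hu4⟩
    · exact ⟨1, one_mem _, fun h' => (h h').elim⟩
  obtain ⟨x, hx, hmax⟩ : ∃ x : G, u ∈ zpowers x ∧ ∀ y : G, u ∈ zpowers y → orderOf y ≤ orderOf x := by
    have hfin : {x : G | u ∈ zpowers x}.Finite := Set.toFinite _
    obtain ⟨x, hx, hx'⟩ := Set.exists_max_image _ (fun x => orderOf x) hfin ⟨u, mem_zpowers u⟩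
    exact ⟨x, hx, hx'⟩
  by_cases htop : zpowers x = ⊤
  · exact ⟨x, fun g => show g ∈ zpowers x from htop ▸ mem_top g⟩
  exfalso
  have hnil : Group.IsNilpotent G := hG.isNilpotent
  have hlt := (Group.normalizerCondition_of_isNilpotent (G := G)) (zpowers x) (lt_top_iff_ne_top.2 htop)
  obtain ⟨y₀, hy₀N, hy₀⟩ := SetLike.exists_of_lt hlt
  obtain ⟨k, hyA, hyp⟩ := exists_pow_prime_mem_of_not_mem hG hy₀
  have hyN := pow_mem hy₀N (p ^ k)
  set y := y₀ ^ p ^ k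
  obtain ⟨r, hr⟩ : ∃ r : ℕ, y * x * y⁻¹ = x ^ r := by
    have := (mem_normalizer_iff.1 hyN x).1 (mem_zpowers x)
    obtain ⟨r, hr⟩ := mem_powers_iff_mem_zpowers.2 this
    exact ⟨r, hr.symm⟩
  obtain ⟨m, hm⟩ := IsPGroup.iff_orderOf.1 hG x
  have key : ∀ w : G, w ∉ zpowers x → u ∈ zpowers w → ¬ x ∈ zpowers w := by
    intro w hw huw hxw
    have h1 : zpowers x < zpowers w :=
      lt_of_le_of_ne (zpowers_le.2 hxw) fun h => hw (h ▸ mem_zpowers w)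
    have h2 := hmax w huw
    rw [← Nat.card_zpowers, ← Nat.card_zpowers] at h2
    exact h1.ne (Subgroup.eq_of_le_of_card_ge h1.le h2)
  have hm0 : m ≠ 0 := by
    rintro rfl
    rw [pow_zero, orderOf_eq_one_iff] at hm
    subst hm
    have hu1 : u = 1 := by simpa using hx
    exact key y hyA (hu1 ▸ one_mem _) (one_mem _)
  -- The map `x ↦ x ^ r` fixes the central element `u ∈ ⟨x⟩`, which has order `4`.
  have hr4 : p = 2 → r ≡ 1 [MOD 4] := by
    intro h2
    obtain ⟨j, hj⟩ := mem_powers_iff_mem_zpowers.2 hx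
    have hc : y * u = u * y := (mem_center_iff.1 hu y)
    have h3 : u ^ r = u := by
      calc u ^ r = (x ^ r) ^ j := by
            show u ^ r = _
            rw [← hj]; simp only [← pow_mul, mul_comm]
        _ = y * x ^ j * y⁻¹ := by rw [← hr, conj_pow]
        _ = u := by
            have : x ^ j = u := hj
            rw [this, hc]; group
    rw [← hu4 h2]
    exact pow_eq_pow_iff_modEq.1 (by rw [h3, pow_one])
  rcases mem_zpowers_or_exists_pow_eq_one hp hm0 hm hr hyp hr4 with h | ⟨i, hi⟩
  · exact key y hyA ((zpowers_le.2 h) hx) h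
  -- The corrected element has order `p` and lies outside `⟨x⟩`, which already contains a subgroup
  -- of order `p`.
  · have ht : x ^ i * y ∉ zpowers x := fun h =>
      hyA ((Subgroup.mul_mem_cancel_left _ (pow_mem (mem_zpowers x) i)).1 h)
    have ht1 : orderOf (x ^ i * y) = p :=
      orderOf_eq_prime hi fun h => ht (h ▸ one_mem _)
    have hs : orderOf (x ^ p ^ (m - 1)) = p := by
      have hne : p ^ (m - 1) ≠ 0 := (pow_pos hp.pos _).ne'
      rw [orderOf_pow_of_dvd hne (hm ▸ pow_dvd_pow p (by omega)), hm,
        Nat.pow_div (by omega) hp.pos, show m - (m - 1) = 1 by omega, pow_one]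
    exact ht (zpowers_le.2 (pow_mem (mem_zpowers x) _) (huniq _ _ hs ht1))

theorem exists_central_of_order_prime [Nontrivial G] (hp : p.Prime) (hG : IsPGroup p G) :
    ∃ z ∈ center G, orderOf z = p := by
  have : Fact p.Prime := ⟨hp⟩
  have := hG.center_nontrivial
  have hdvd : p ∣ Nat.card (center G) := by
    obtain ⟨k, hk0, hk⟩ := (hG.to_subgroup (center G)).nontrivial_iff_card.1 this
    rw [hk]
    exact dvd_pow_self p hk0.ne'
  obtain ⟨z, hz⟩ := exists_prime_orderOf_dvd_card' p hdvd
  exact ⟨z, z.2, by rw [Subgroup.orderOf_coe, hz]⟩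

/-- For odd `p` the group is cyclic. For `p = 2`, lift a central involution of `G/⟨z⟩` to `u`;
uniqueness of the involution forces `u` to have order `4`. Its only possible conjugates are `u` and
`z * u`, so its centralizer has index at most `2`. There `u` is central, so the previous theorem
makes the centralizer cyclic. -/
theorem exists_pow_dvd_orderOf_of_unique_subgroup {n : ℕ} (hp : p.Prime) (hn : n ≠ 0)
    (hG : Nat.card G = p ^ n)
    (huniq : ∀ s t : G, orderOf s = p → orderOf t = p → t ∈ zpowers s) :
    ∃ x : G, p ^ (n - 1) ∣ orderOf x := by
  classical
  have : Fact p.Prime := ⟨hp⟩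
  have hP : IsPGroup p G := IsPGroup.of_card hG
  have hcyc : IsCyclic G → ∃ x : G, p ^ (n - 1) ∣ orderOf x := by
    rintro ⟨x, hx⟩
    refine ⟨x, ?_⟩
    rw [orderOf_eq_card_of_forall_mem_zpowers hx, hG]
    exact pow_dvd_pow p (by omega)
  by_cases h2 : p = 2
  swap
  · exact hcyc (isCyclic_of_unique_subgroup_of_order_prime hp hP huniq fun h => (h2 h).elim)
  subst h2
  obtain rfl | hn2 : n = 1 ∨ 2 ≤ n := by omega
  · exact ⟨1, by simp⟩
  have : Nontrivial G := hP.nontrivial_iff_card.2 ⟨n, by omega, hG⟩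
  obtain ⟨z, hzc, hz⟩ := exists_central_of_order_prime hp hP
  have hZ : (zpowers z).Normal := ⟨fun a ha g => by
    have hac : a ∈ center G := zpowers_le.2 hzc ha
    rw [mem_center_iff.1 hac g]; simpa using ha⟩
  have hcard : Nat.card (G ⧸ zpowers z) * 2 = 2 ^ n := by
    rw [← hG, Subgroup.card_eq_card_quotient_mul_card_subgroup (zpowers z), Nat.card_zpowers, hz]
  have hcardQ : Nat.card (G ⧸ zpowers z) = 2 ^ (n - 1) := by
    have : 2 ^ n = 2 ^ (n - 1) * 2 := by rw [← pow_succ]; congr 1; omega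
    omega
  have hPQ : IsPGroup 2 (G ⧸ zpowers z) := IsPGroup.of_card hcardQ
  have : Nontrivial (G ⧸ zpowers z) := hPQ.nontrivial_iff_card.2 ⟨n - 1, by omega, hcardQ⟩
  obtain ⟨q, hqc, hq⟩ := exists_central_of_order_prime hp hPQ
  obtain ⟨u, rfl⟩ := QuotientGroup.mk_surjective q
  have huZ : u ∉ zpowers z := by
    intro h
    rw [(QuotientGroup.eq_one_iff u).2 h, orderOf_one] at hq
    omega
  have hu2 : u ^ 2 ∈ zpowers z := by
    rw [← QuotientGroup.eq_one_iff, QuotientGroup.mk_pow, ← hq, pow_orderOf_eq_one]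
  have hZmem : ∀ a, a ∈ zpowers z → a = 1 ∨ a = z := by
    intro a ha
    obtain ⟨k, rfl⟩ := mem_powers_iff_mem_zpowers.2 ha
    show z ^ k = 1 ∨ z ^ k = z
    rw [← pow_mod_orderOf, hz]
    rcases Nat.mod_two_eq_zero_or_one k with h | h <;> simp [h]
  have hu2z : u ^ 2 = z := by
    rcases hZmem _ hu2 with h | h
    · exact (huZ (huniq z u hz (orderOf_eq_prime h fun h1 => huZ (h1 ▸ one_mem _)))).elim
    · exact h
  have hu4 : orderOf u = 4 := by
    have hz1 : z ≠ 1 := by rintro rfl; simp at hz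
    have := orderOf_eq_prime_pow (x := u) (p := 2) (n := 1) (by simpa [hu2z] using hz1)
      (by rw [show 2 ^ (1 + 1) = 2 * 2 by rfl, pow_mul, hu2z, ← hz, pow_orderOf_eq_one])
    simpa using this
  have hconj : ∀ g, g * u * g⁻¹ * u⁻¹ = 1 ∨ g * u * g⁻¹ * u⁻¹ = z := by
    intro g
    refine hZmem _ ?_
    rw [← QuotientGroup.eq_one_iff]
    have h1 := mem_center_iff.1 hqc (g : G ⧸ zpowers z)
    simp only [QuotientGroup.mk_mul, QuotientGroup.mk_inv, h1]
    group
  set C := centralizer ({u} : Set G) with hC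
  have hmemC : ∀ g, g ∈ C ↔ g * u = u * g := by
    intro g; rw [hC, mem_centralizer_singleton_iff]
  have hcycC : IsCyclic C := by
    refine isCyclic_of_unique_subgroup_of_order_prime hp (hP.to_subgroup C) ?_ fun _ => ?_
    · intro s t hs ht
      have := huniq s t (by rw [Subgroup.orderOf_coe, hs]) (by rw [Subgroup.orderOf_coe, ht])
      obtain ⟨k, hk⟩ := this
      exact ⟨k, Subtype.ext (by simpa using hk)⟩
    · refine ⟨⟨u, (hmemC u).2 rfl⟩, ?_, ?_⟩
      · rw [mem_center_iff]
        rintro ⟨g, hg⟩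
        exact Subtype.ext ((hmemC g).1 hg)
      · rw [← hu4, Subgroup.orderOf_mk]
  have hidx : C.index ∣ 2 := by
    by_cases htop : C = ⊤
    · simp [htop]
    obtain ⟨a, -, ha⟩ := SetLike.exists_of_lt (lt_top_iff_ne_top.2 htop)
    have haz : a * u * a⁻¹ = z * u := by
      rcases hconj a with h | h
      · refine (ha ((hmemC a).2 ?_)).elim
        exact mul_inv_eq_iff_eq_mul.1 (mul_inv_eq_one.1 h)
      · rw [← h]; group
    refine dvd_of_eq ((index_eq_two_iff).2 ⟨a, fun b => ?_⟩)
    have hbz : b ∈ C ↔ b * u * b⁻¹ = u := by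
      rw [hmemC, mul_inv_eq_iff_eq_mul]
    have hbaz : b * a ∈ C ↔ z * (b * u * b⁻¹) = u := by
      rw [hmemC, ← mul_inv_eq_iff_eq_mul]
      have : b * a * u * (b * a)⁻¹ = b * (a * u * a⁻¹) * b⁻¹ := by group
      rw [this, haz, ← mul_assoc b z, mem_center_iff.1 hzc b]
      simp only [mul_assoc]
    have hz1 : z * u ≠ u := by
      intro h
      rw [mul_eq_right] at h
      subst h; simp at hz
    have hzz : z * (z * u) = u := by
      rw [← mul_assoc, ← pow_two, ← hz, pow_orderOf_eq_one, one_mul]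
    have hb : b * u * b⁻¹ = u ∨ b * u * b⁻¹ = z * u := by
      rcases hconj b with h | h
      · exact .inl (mul_inv_eq_one.1 h)
      · exact .inr (mul_inv_eq_iff_eq_mul.1 h)
    rw [hbz, hbaz]
    rcases hb with h | h <;> rw [h]
    · exact .inr ⟨rfl, hz1⟩
    · exact .inl ⟨hzz, hz1⟩
  obtain ⟨⟨x, hxC⟩, hx⟩ := hcycC
  refine ⟨x, ?_⟩
  have h1 := orderOf_eq_card_of_forall_mem_zpowers hx
  rw [Subgroup.orderOf_mk] at h1
  rw [h1]
  have h2 := C.card_mul_index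
  rw [hG, show 2 ^ n = 2 ^ (n - 1) * 2 by rw [← pow_succ]; congr 1; omega] at h2
  obtain ⟨c, hc⟩ := hidx
  have h3 : Nat.card C * C.index = 2 ^ (n - 1) * c * C.index := by
    rw [h2, mul_assoc, mul_comm c, ← hc]
  exact ⟨c, Nat.eq_of_mul_eq_mul_right (Nat.pos_of_ne_zero Subgroup.index_ne_zero_of_finite) h3⟩

end UniqueSubgroup

/-! ### Cyclic subgroups of a quotient by a normal subgroup of order p. -/

theorem totient_prime_mul_le {p m : ℕ} (hp : p.Prime) : (p * m).totient ≤ p * m.totient := by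
  by_cases h : p ∣ m
  · rw [Nat.totient_mul_of_prime_of_dvd hp h]
  · rw [Nat.totient_mul_of_prime_of_not_dvd hp h]
    exact Nat.mul_le_mul_right _ (Nat.sub_le _ _)

theorem card_filter_mk_eq {G : Type*} [Group G] [Fintype G] [DecidableEq G] {p : ℕ}
    (Z : Subgroup G) [Z.Normal] [DecidableEq (G ⧸ Z)] (hZ : Nat.card Z = p) (q : G ⧸ Z) :
    (Finset.univ.filter fun g : G => (g : G ⧸ Z) = q).card = p := by
  classical
  obtain ⟨g₀, rfl⟩ := QuotientGroup.mk_surjective q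
  rw [← hZ, Nat.card_eq_fintype_card, ← Finset.card_univ]
  symm
  refine Finset.card_bij (fun a _ => g₀ * (a : G)) ?_ ?_ ?_
  · intro a _
    simp
  · intro a _ b _ h
    exact Subtype.ext (mul_left_cancel h)
  · intro b hb
    simp only [Finset.mem_filter, Finset.mem_univ, true_and] at hb
    exact ⟨⟨g₀⁻¹ * b, QuotientGroup.eq.1 hb.symm⟩, Finset.mem_univ _, by simp⟩

theorem pow_orderOf_mk_mul_card {G : Type*} [Group G] (Z : Subgroup G) [Z.Normal] (g : G) :
    g ^ (orderOf (g : G ⧸ Z) * Nat.card Z) = 1 := by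
  have h : g ^ orderOf (g : G ⧸ Z) ∈ Z := by
    rw [← QuotientGroup.eq_one_iff, QuotientGroup.mk_pow, pow_orderOf_eq_one]
  have := pow_card_eq_one' (x := (⟨_, h⟩ : Z))
  rw [pow_mul]
  exact congrArg Subtype.val this

/-- Passing from `G` to the quotient by a normal subgroup of order `p` loses one cyclic subgroup,
and further ones wherever elements of the quotient lift without increasing their order. -/
theorem card_cyclicSubgroups_quotient_add_le {G : Type*} [Group G] [Finite G] {p : ℕ}
    (hp : p.Prime) (Z : Subgroup G) [Z.Normal] (hZ : Nat.card Z = p) (F : Finset (G ⧸ Z))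
    (hF : ∀ q ∈ F, q ≠ 1 ∧ ∀ g : G, (g : G ⧸ Z) = q → orderOf g = orderOf q) :
    (Nat.card (cyclicSubgroups (G ⧸ Z)) : ℚ) + 1 +
      ∑ q ∈ F, ((p : ℚ) - 1) * ((orderOf q).totient : ℚ)⁻¹ ≤ Nat.card (cyclicSubgroups G) := by
  classical
  have := Fintype.ofFinite G
  have hp0 : (0 : ℚ) < p := by exact_mod_cast hp.pos
  have hp1 : (0 : ℚ) < (p : ℚ) - 1 := by
    have : (1 : ℚ) < p := by exact_mod_cast hp.one_lt
    linarith
  rw [card_cyclicSubgroups_eq_sum, card_cyclicSubgroups_eq_sum,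
    ← Finset.sum_fiberwise (s := Finset.univ) (g := fun g : G => (g : G ⧸ Z))]
  have hFs : ∑ q ∈ F, ((p : ℚ) - 1) * ((orderOf q).totient : ℚ)⁻¹ =
      ∑ q : G ⧸ Z, if q ∈ F then ((p : ℚ) - 1) * ((orderOf q).totient : ℚ)⁻¹ else 0 := by
    rw [Finset.sum_ite_mem, Finset.univ_inter]
  have hone : ∑ q : G ⧸ Z, (if q = 1 then 1 else 0 : ℚ) = 1 := by simp
  refine le_of_eq_of_le (b := ∑ q : G ⧸ Z, (((orderOf q).totient : ℚ)⁻¹ + (if q = 1 then 1 else 0) +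
    if q ∈ F then ((p : ℚ) - 1) * ((orderOf q).totient : ℚ)⁻¹ else 0)) ?_ ?_
  · rw [Finset.sum_add_distrib, Finset.sum_add_distrib, hFs, hone]
  refine Finset.sum_le_sum fun q _ => ?_
  have hcard := card_filter_mk_eq Z hZ q
  by_cases hq1 : q = 1
  -- The coset is `Z` itself: the identity weighs `1`, and the `p - 1` others together weigh `1`
  -- more.
  · subst hq1
    have hnF : (1 : G ⧸ Z) ∉ F := fun h => (hF 1 h).1 rfl
    simp only [hnF, if_true, if_false, orderOf_one, Nat.totient_one, Nat.cast_one, inv_one]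
    have hmem : (1 : G) ∈ Finset.univ.filter fun g : G => (g : G ⧸ Z) = 1 := by simp
    rw [← Finset.add_sum_erase _ _ hmem]
    have hle : ∑ g ∈ (Finset.univ.filter fun g : G => (g : G ⧸ Z) = 1).erase 1, ((p : ℚ) - 1)⁻¹ ≤
        ∑ g ∈ (Finset.univ.filter fun g : G => (g : G ⧸ Z) = 1).erase 1,
          ((orderOf g).totient : ℚ)⁻¹ := by
      refine Finset.sum_le_sum fun g hg => ?_
      have hg' : (g : G ⧸ Z) = 1 := by simpa using (Finset.mem_filter.1 (Finset.mem_of_mem_erase hg)).2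
      have hgp : g ^ p = 1 := by
        have := pow_orderOf_mk_mul_card Z g
        rwa [hg', orderOf_one, one_mul, hZ] at this
      have : Fact p.Prime := ⟨hp⟩
      rw [orderOf_eq_prime hgp (Finset.ne_of_mem_erase hg), Nat.totient_prime hp,
        Nat.cast_pred hp.pos]
    rw [Finset.sum_const, Finset.card_erase_of_mem hmem, hcard, nsmul_eq_mul, Nat.cast_pred hp.pos,
      mul_inv_cancel₀ hp1.ne'] at hle
    simp only [orderOf_one, Nat.totient_one, Nat.cast_one, inv_one]
    linarith
  · have hpos := totient_orderOf_pos q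
    rw [if_neg hq1, add_zero]
    split_ifs with hqF
    -- All `p` lifts keep the weight of `q`, so the excess is `p - 1` times that weight.
    · have h1 : ∀ g ∈ Finset.univ.filter fun g : G => (g : G ⧸ Z) = q,
          ((orderOf g).totient : ℚ)⁻¹ = ((orderOf q).totient : ℚ)⁻¹ := by
        intro g hg
        rw [(hF q hqF).2 g (Finset.mem_filter.1 hg).2]
      rw [Finset.sum_congr rfl h1, Finset.sum_const, hcard, nsmul_eq_mul]
      linarith
    -- In general each lift has at least `1/p` of the weight of `q`, so the `p` lifts lose nothing
    -- together.
    · have h1 : ∑ g ∈ Finset.univ.filter (fun g : G => (g : G ⧸ Z) = q),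
            ((p : ℚ) * (orderOf q).totient)⁻¹ ≤
          ∑ g ∈ Finset.univ.filter (fun g : G => (g : G ⧸ Z) = q),
            ((orderOf g).totient : ℚ)⁻¹ := by
        refine Finset.sum_le_sum fun g hg => ?_
        refine inv_anti₀ (totient_orderOf_pos g) ?_
        have hgq : (g : G ⧸ Z) = q := (Finset.mem_filter.1 hg).2
        have h2 : orderOf g ∣ p * orderOf q := by
          have := orderOf_dvd_of_pow_eq_one (pow_orderOf_mk_mul_card Z g)
          rwa [hgq, hZ, mul_comm] at this
        have h3 : (orderOf g).totient ≤ p * (orderOf q).totient :=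
          (Nat.le_of_dvd (Nat.totient_pos.2 (Nat.mul_pos hp.pos (orderOf_pos q)))
            (Nat.totient_dvd_of_dvd h2)).trans (totient_prime_mul_le hp)
        exact_mod_cast h3
      rw [Finset.sum_const, hcard, nsmul_eq_mul, mul_inv, mul_inv_cancel_left₀ hp0.ne'] at h1
      linarith

/-- With `c = p - 1` this evaluates the gain from one cyclic subgroup of the quotient whose
generators keep their order when lifted. -/
theorem sum_filter_zpowers_eq {G : Type*} [Group G] [Fintype G]
    (g₀ : G) [DecidablePred fun g : G => zpowers g = zpowers g₀] (c : ℚ) :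
    ∑ g : G with zpowers g = zpowers g₀, c * ((orderOf g).totient : ℚ)⁻¹ = c := by
  have h1 : ∀ g ∈ Finset.univ.filter (fun g : G => zpowers g = zpowers g₀),
      c * ((orderOf g).totient : ℚ)⁻¹ = c * ((orderOf g₀).totient : ℚ)⁻¹ := by
    intro g hg
    rw [← Nat.card_zpowers, (Finset.mem_filter.1 hg).2, Nat.card_zpowers]
  rw [Finset.sum_congr rfl h1, Finset.sum_const, card_filter_zpowers_eq, nsmul_eq_mul,
    mul_left_comm, mul_inv_cancel₀ (totient_orderOf_pos g₀).ne', mul_one]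

theorem orderOf_eq_of_zpowers_eq {G : Type*} [Group G] {a b : G} (h : zpowers a = zpowers b) :
    orderOf a = orderOf b := by
  rw [← Nat.card_zpowers, h, Nat.card_zpowers]

/-! ### Groups with a cyclic subgroup of index p: the split case. -/

section CyclicMaximal

variable {G : Type*} [Group G] {p m : ℕ} {x : G}

theorem index_zpowers_eq_prime (hp : p.Prime) (hG : Nat.card G = p ^ (m + 1))
    (hx : orderOf x = p ^ m) : (zpowers x).index = p := by
  have h := (zpowers x).card_mul_index
  rw [hG, Nat.card_zpowers, hx, pow_succ] at h
  exact Nat.eq_of_mul_eq_mul_left (pow_pos hp.pos m) h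

theorem pow_notMem_zpowers (hp : p.Prime) {y : G} (hy : y ∉ zpowers x) (hyp : y ^ p = 1) {j : ℕ}
    (hj : ¬ p ∣ j) : y ^ j ∉ zpowers x := by
  intro h
  have : Fact p.Prime := ⟨hp⟩
  have ho : orderOf y = p := orderOf_eq_prime hyp fun h1 => hy (h1 ▸ one_mem _)
  obtain ⟨k, hk⟩ := exists_pow_eq_self_of_coprime (x := y) (n := j)
    (by rw [ho]; exact (hp.coprime_iff_not_dvd.2 hj).symm)
  exact hy (hk ▸ pow_mem h k)

theorem normal_zpowers_of_card (hp : p.Prime) (hG : Nat.card G = p ^ (m + 1))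
    (hx : orderOf x = p ^ m) : (zpowers x).Normal := by
  refine normal_of_index_eq_minFac_card ?_
  rw [index_zpowers_eq_prime hp hG hx, hG, hp.pow_minFac (by omega)]

theorem pow_prime_mem_zpowers (hp : p.Prime) (hG : Nat.card G = p ^ (m + 1))
    (hx : orderOf x = p ^ m) (y : G) : y ^ p ∈ zpowers x := by
  have := normal_zpowers_of_card hp hG hx
  have h := (zpowers x).pow_index_mem y
  rwa [index_zpowers_eq_prime hp hG hx] at h

theorem eq_top_of_mem_of_notMem (hp : p.Prime) (hG : Nat.card G = p ^ (m + 1))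
    (hx : orderOf x = p ^ m) {H : Subgroup G} {y : G} (hxH : x ∈ H) (hyH : y ∈ H)
    (hy : y ∉ zpowers x) : H = ⊤ := by
  have h1 : (zpowers x).relIndex H * H.index = p := by
    rw [relIndex_mul_index (zpowers_le.2 hxH), index_zpowers_eq_prime hp hG hx]
  rcases (Nat.dvd_prime hp).1 ⟨_, h1.symm⟩ with h | h
  · exact (hy (relIndex_eq_one.1 h hyH)).elim
  · rw [h] at h1
    exact index_eq_one.1 (Nat.eq_of_mul_eq_mul_left hp.pos (by simpa using h1))

theorem exists_notMem_zpowers (hp : p.Prime) (hG : Nat.card G = p ^ (m + 1))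
    (hx : orderOf x = p ^ m) : ∃ y, y ∉ zpowers x := by
  by_contra! h
  have h1 := index_zpowers_eq_prime hp hG hx
  rw [(eq_top_iff' _).2 h, index_top] at h1
  exact hp.one_lt.ne h1

theorem isCyclic_of_mem_zpowers (hp : p.Prime) (hG : Nat.card G = p ^ (m + 1))
    (hx : orderOf x = p ^ m) {y : G} (hy : y ∉ zpowers x) (h : x ∈ zpowers y) : IsCyclic G := by
  have htop := eq_top_of_mem_of_notMem hp hG hx h (mem_zpowers y) hy
  exact ⟨y, fun g => show g ∈ zpowers y from htop ▸ mem_top g⟩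

variable [Finite G]

/-- `⟨x⟩` together with `y` gives `p ^ m + 1` solutions of `g ^ p ^ m = 1`, too many for a cyclic
group. -/
theorem not_isCyclic_of_pow_eq_one (hp : p.Prime) (hm : m ≠ 0) (hx : orderOf x = p ^ m) {y : G}
    (hy : y ∉ zpowers x) (hyp : y ^ p = 1) : ¬ IsCyclic G := by
  intro hc
  have := Fintype.ofFinite G
  classical
  have h1 := IsCyclic.card_pow_eq_one_le (α := G) (pow_pos hp.pos m)
  have h2 : insert y (Finset.univ.filter fun g : G => g ∈ zpowers x) ⊆
      Finset.univ.filter fun g : G => g ^ p ^ m = 1 := by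
    intro g hg
    simp only [Finset.mem_insert, Finset.mem_filter, Finset.mem_univ, true_and] at hg ⊢
    rcases hg with rfl | hg
    · obtain ⟨c, hc⟩ := dvd_pow_self p hm
      rw [hc, pow_mul, hyp, one_pow]
    · obtain ⟨k, rfl⟩ := hg
      simp only
      rw [← hx, ← zpow_natCast, ← zpow_mul, mul_comm, zpow_mul, zpow_natCast, pow_orderOf_eq_one,
        one_zpow]
  have h3 := Finset.card_le_card h2
  rw [Finset.card_insert_of_notMem (by simpa using hy)] at h3
  have h4 : (Finset.univ.filter fun g : G => g ∈ zpowers x).card = p ^ m := by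
    rw [← hx, ← Nat.card_zpowers, Nat.card_eq_fintype_card, Fintype.card_subtype]
  omega

theorem sum_zpowers_inv_totient [Fintype (zpowers x)] (hp : p.Prime) (hx : orderOf x = p ^ m) :
    ∑ a : zpowers x, ((orderOf (a : G)).totient : ℚ)⁻¹ = m + 1 := by
  have h := card_cyclicSubgroups_eq_sum (zpowers x)
  rw [card_cyclicSubgroups_of_isCyclic, Nat.card_zpowers, hx, Nat.divisors_prime_pow hp,
    Finset.card_map, Finset.card_range] at h
  simp only [Subgroup.orderOf_coe]
  rw [← h]; push_cast; rfl

theorem card_cyclicSubgroups_eq_add_sum [Fintype G] [DecidablePred (· ∈ zpowers x)]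
    (hp : p.Prime) (hx : orderOf x = p ^ m) :
    (Nat.card (cyclicSubgroups G) : ℚ) =
      m + 1 + ∑ g : G with g ∉ zpowers x, ((orderOf g).totient : ℚ)⁻¹ := by
  classical
  rw [card_cyclicSubgroups_eq_sum, ← Finset.sum_filter_add_sum_filter_not _ (· ∈ zpowers x),
    ← sum_zpowers_inv_totient hp hx]
  congr 1
  exact Finset.sum_subtype _ (by simp) _

/-- `(a * w) ^ p = (a ^ p) ^ u` with `p ∤ u`, so the two `p`-th powers have equal order; as neither
element is trivial, the elements themselves do too. -/
theorem orderOf_mul_eq_of_conj {w a : G} {r : ℕ} (hp : p.Prime) (hx : orderOf x = p ^ m)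
    (h : w * x * w⁻¹ = x ^ r) (hr : r ≡ 1 [MOD p]) (hr' : p = 2 → r ≡ 1 [MOD 4])
    (hw : w ∉ zpowers x) (hwp : w ^ p = 1) (ha : a ∈ zpowers x) (ha1 : a ≠ 1) :
    orderOf (a * w) = orderOf a := by
  obtain ⟨i, rfl⟩ := mem_powers_iff_mem_zpowers.2 ha
  simp only at ha1 ⊢
  obtain ⟨u, hu, hpu⟩ := exists_geom_sum_eq_prime_mul hp hr hr'
  have h1 : (x ^ i * w) ^ p = ((x ^ i) ^ p) ^ u := by
    rw [pow_mul_pow_of_conj h, hu, hwp, mul_one, pow_mul, pow_mul]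
  obtain ⟨k, -, hk⟩ := orderOf_eq_prime_pow_of_pow_eq_one hp (k := m) (g := x ^ i)
    (by rw [← pow_mul, mul_comm, pow_mul, ← hx, pow_orderOf_eq_one, one_pow])
  have hk0 : k ≠ 0 := by
    rintro rfl
    exact ha1 (orderOf_eq_one_iff.1 (by simpa using hk))
  have h2 : orderOf ((x ^ i * w) ^ p) = p ^ (k - 1) := by
    have h3 : orderOf ((x ^ i) ^ p) = p ^ (k - 1) := by
      rw [orderOf_pow_of_dvd hp.ne_zero (hk ▸ dvd_pow_self p hk0), hk]
      conv_lhs => rw [show k = (k - 1) + 1 by omega, pow_succ]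
      exact Nat.mul_div_cancel _ hp.pos
    rw [h1, Nat.Coprime.orderOf_pow, h3]
    rw [h3]
    exact Nat.Coprime.pow_left _ (hp.coprime_iff_not_dvd.2 hpu)
  have hne : x ^ i * w ≠ 1 := fun h0 =>
    hw ((Subgroup.mul_mem_cancel_left _ ha).1 (by
      show x ^ i * w ∈ zpowers x
      rw [h0]; exact one_mem _))
  have hdvd : p ∣ orderOf (x ^ i * w) := by
    have h4 : (x ^ i * w) ^ p ^ k = 1 := by
      rw [show p ^ k = p * p ^ (k - 1) by rw [← pow_succ']; congr 1; omega, pow_mul, ← h2,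
        pow_orderOf_eq_one]
    obtain ⟨l, -, hl⟩ := orderOf_eq_prime_pow_of_pow_eq_one hp h4
    rw [hl]
    refine dvd_pow_self p ?_
    rintro rfl
    exact hne (orderOf_eq_one_iff.1 (by simpa using hl))
  rw [orderOf_pow_of_dvd hp.ne_zero hdvd] at h2
  rw [← Nat.div_mul_cancel hdvd, h2, hk, ← pow_succ]
  congr 1; omega

/-- `G` is the disjoint union of the cosets `⟨x⟩ y ^ j`, `j < p`. The coset `j = 0` has weight `m +
1`. Each other one has the same weights except that `y ^ j`, of order `p`, replaces the identity,
which gives `m + 1/(p - 1)`. -/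
theorem card_cyclicSubgroups_of_conj {y : G} {r : ℕ} (hp : p.Prime)
    (hG : Nat.card G = p ^ (m + 1)) (hx : orderOf x = p ^ m)
    (h : y * x * y⁻¹ = x ^ r) (hr : r ≡ 1 [MOD p]) (hr' : p = 2 → r ≡ 1 [MOD 4])
    (hy : y ∉ zpowers x) (hyp : y ^ p = 1) : Nat.card (cyclicSubgroups G) = 2 + m * p := by
  classical
  have := Fintype.ofFinite G
  have : Fact p.Prime := ⟨hp⟩
  let f : zpowers x × Fin p → G := fun a => a.1 * y ^ (a.2 : ℕ)
  have hinj : Function.Injective f := by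
    have key : ∀ (a b : zpowers x) (i j : Fin p), j ≤ i → f (a, i) = f (b, j) → i = j := by
      intro a b i j hij hab
      simp only [f] at hab
      have h1 : y ^ ((i : ℕ) - j) ∈ zpowers x := by
        have : y ^ ((i : ℕ) - j) = (a : G)⁻¹ * b := by
          rw [pow_sub _ (by exact_mod_cast hij)]
          rw [mul_inv_eq_iff_eq_mul, mul_assoc, ← hab, inv_mul_cancel_left]
        rw [this]
        exact mul_mem (inv_mem a.2) b.2
      by_contra hne
      refine pow_notMem_zpowers hp hy hyp (fun hd => ?_) h1
      have hlt : (j : ℕ) < i := lt_of_le_of_ne hij fun h => hne (Fin.ext h.symm)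
      have := Nat.le_of_dvd (by omega) hd
      have := i.2
      omega
    rintro ⟨a, i⟩ ⟨b, j⟩ hab
    have hij : i = j := by
      rcases le_total j i with hle | hle
      · exact key a b i j hle hab
      · exact (key b a j i hle hab.symm).symm
    subst hij
    simp only [f, mul_left_inj] at hab
    rw [Subtype.ext hab]
  have hbij : Function.Bijective f := by
    rw [Fintype.bijective_iff_injective_and_card]
    refine ⟨hinj, ?_⟩
    rw [Fintype.card_prod, Fintype.card_fin, ← Nat.card_eq_fintype_card, ← Nat.card_eq_fintype_card,
      Nat.card_zpowers, hx, hG, pow_succ]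
  have hp1 : (0 : ℚ) < (p : ℚ) - 1 := by
    have : (1 : ℚ) < p := by exact_mod_cast hp.one_lt
    linarith
  have hsum : (Nat.card (cyclicSubgroups G) : ℚ) = 2 + m * p := by
    rw [card_cyclicSubgroups_eq_sum, ← (Equiv.ofBijective f hbij).sum_comp, Fintype.sum_prod_type_right]
    have hterm : ∀ j : Fin p, ∑ a : zpowers x,
        ((orderOf (Equiv.ofBijective f hbij (a, j))).totient : ℚ)⁻¹ =
          if (j : ℕ) = 0 then (m + 1 : ℚ) else m + ((p : ℚ) - 1)⁻¹ := by
      intro j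
      simp only [Equiv.ofBijective_apply, f]
      split_ifs with hj
      · simp only [hj, pow_zero, mul_one]
        exact sum_zpowers_inv_totient hp hx
      · have hpj : ¬ p ∣ (j : ℕ) := fun hd => by
          have := Nat.le_of_dvd (Nat.pos_of_ne_zero hj) hd
          have := j.2
          omega
        have hw := pow_notMem_zpowers hp hy hyp hpj
        have hwp : (y ^ (j : ℕ)) ^ p = 1 := by rw [← pow_mul, mul_comm, pow_mul, hyp, one_pow]
        have hrj : r ^ (j : ℕ) ≡ 1 [MOD p] := by simpa using hr.pow j
        have hrj' : p = 2 → r ^ (j : ℕ) ≡ 1 [MOD 4] := fun h2 => by simpa using (hr' h2).pow j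
        have h0 := sum_zpowers_inv_totient hp hx
        rw [← Finset.add_sum_erase _ _ (Finset.mem_univ (1 : zpowers x))] at h0 ⊢
        have h1 : ∀ a ∈ Finset.univ.erase (1 : zpowers x),
            ((orderOf ((a : G) * y ^ (j : ℕ))).totient : ℚ)⁻¹ = ((orderOf (a : G)).totient : ℚ)⁻¹ := by
          intro a ha
          rw [orderOf_mul_eq_of_conj hp hx (conj_pow_pow h j) hrj hrj' hw hwp a.2 fun h1 =>
            Finset.ne_of_mem_erase ha (Subtype.ext h1)]
        rw [Finset.sum_congr rfl h1]
        simp only [OneMemClass.coe_one, orderOf_one, Nat.totient_one, Nat.cast_one, inv_one,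
          one_mul] at h0 ⊢
        rw [orderOf_eq_prime hwp fun h1 => hw (h1 ▸ one_mem _), Nat.totient_prime hp,
          Nat.cast_pred hp.pos]
        linarith
    rw [Finset.sum_congr rfl fun j _ => hterm j, Fin.sum_univ_eq_sum_range
      (fun j => if j = 0 then (m + 1 : ℚ) else m + ((p : ℚ) - 1)⁻¹) p]
    obtain ⟨q, hq⟩ : ∃ q, p = q + 1 := ⟨p - 1, by have := hp.pos; omega⟩
    have hq1 : (p : ℚ) - 1 = q := by rw [hq]; push_cast; ring
    rw [hq1] at hp1 ⊢
    rw [hq, Finset.sum_range_succ']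
    simp only [Nat.add_eq_zero_iff, one_ne_zero, and_false, if_false, if_true, Finset.sum_const,
      Finset.card_range, nsmul_eq_mul]
    push_cast
    field_simp
    ring
  exact_mod_cast hsum

end CyclicMaximal

/-! ### The split/non-split dichotomy, and 2-groups of quaternion type. -/

section CyclicMaximal

variable {G : Type*} [Group G] {p m : ℕ} {x : G}

theorem card_filter_notMem_zpowers [Fintype G] [DecidablePred (· ∈ zpowers x)]
    (hG : Nat.card G = 2 ^ (m + 1)) (hx : orderOf x = 2 ^ m) :
    (Finset.univ.filter fun g : G => g ∉ zpowers x).card = 2 ^ m := by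
  have h1 : (Finset.univ.filter fun g : G => g ∈ zpowers x).card = 2 ^ m := by
    rw [← hx, ← Nat.card_zpowers, Nat.card_eq_fintype_card, Fintype.card_subtype]
  have h2 := Finset.card_filter_add_card_filter_not (s := (Finset.univ : Finset G))
    (fun g : G => g ∈ zpowers x)
  rw [h1, Finset.card_univ, ← Nat.card_eq_fintype_card, hG, pow_succ] at h2
  omega

variable [Finite G]

/-- For odd `p` the mod `4` condition is void, so any outside element falls under the first
alternative. -/
theorem exists_split_or_forall_not_modEq (hp : p.Prime) (hm : m ≠ 0)
    (hG : Nat.card G = p ^ (m + 1)) (hc : ¬ IsCyclic G) (hx : orderOf x = p ^ m) :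
    (∃ (y : G) (r : ℕ), y ∉ zpowers x ∧ y ^ p = 1 ∧ y * x * y⁻¹ = x ^ r ∧ r ≡ 1 [MOD p] ∧
      (p = 2 → r ≡ 1 [MOD 4])) ∨
    (p = 2 ∧ ∀ (y : G) (r : ℕ), y ∉ zpowers x → y * x * y⁻¹ = x ^ r → ¬ r ≡ 1 [MOD 4]) := by
  by_cases hex : ∃ (y : G) (r : ℕ), y ∉ zpowers x ∧ y * x * y⁻¹ = x ^ r ∧ (p = 2 → r ≡ 1 [MOD 4])
  · left
    obtain ⟨y, r, hy, h, hr'⟩ := hex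
    have hyp := pow_prime_mem_zpowers hp hG hx y
    rcases mem_zpowers_or_exists_pow_eq_one hp hm hx h hyp hr' with h1 | ⟨i, hi⟩
    · exact (hc (isCyclic_of_mem_zpowers hp hG hx hy h1)).elim
    · refine ⟨x ^ i * y, r, fun h2 => hy ?_, hi, ?_, modEq_one_of_conj_of_pow_mem hp hm hx h hyp, hr'⟩
      · exact (Subgroup.mul_mem_cancel_left _ (pow_mem (mem_zpowers x) i)).1 h2
      · calc x ^ i * y * x * (x ^ i * y)⁻¹ = x ^ i * (y * x * y⁻¹) * (x ^ i)⁻¹ := by group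
          _ = x ^ r := by rw [h, ← pow_add, add_comm, pow_add, mul_inv_cancel_right]
  · right
    push Not at hex
    obtain ⟨y, hy⟩ := exists_notMem_zpowers hp hG hx
    obtain ⟨r, hr⟩ := exists_conj_eq_pow (normal_zpowers_of_card hp hG hx) y
    exact ⟨(hex y r hy hr).1, fun y r hy h => (hex y r hy h).2⟩

/-- Write `g ^ 2 = x ^ a`. Since `g` commutes with its square, `2 ^ m` divides `(r - 1) * a`; as `r
- 1` is twice an odd number, `2 ^ (m - 1)` divides `a`. -/
theorem sq_eq_one_or_of_conj_not_modEq (hm : 2 ≤ m)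
    (hG : Nat.card G = 2 ^ (m + 1)) (hx : orderOf x = 2 ^ m)
    (h : ∀ (y : G) (r : ℕ), y ∉ zpowers x → y * x * y⁻¹ = x ^ r → ¬ r ≡ 1 [MOD 4])
    {g : G} (hg : g ∉ zpowers x) : g ^ 2 = 1 ∨ g ^ 2 = x ^ 2 ^ (m - 1) := by
  have hp := Nat.prime_two
  obtain ⟨r, hr⟩ := exists_conj_eq_pow (normal_zpowers_of_card hp hG hx) g
  have hg2 := pow_prime_mem_zpowers hp hG hx g
  have h2 : r ≡ 1 [MOD 2] := modEq_one_of_conj_of_pow_mem hp (by omega) hx hr hg2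
  have h4 := h g r hg hr
  obtain ⟨s, hs⟩ : ∃ s, r = 2 * (2 * s + 1) + 1 := by
    unfold Nat.ModEq at h2 h4
    exact ⟨r / 4, by omega⟩
  obtain ⟨a, ha⟩ := mem_powers_iff_mem_zpowers.2 hg2
  simp only at ha
  have h5 : x ^ (r * a) = x ^ a := by
    have := mul_pow_eq_of_conj hr a
    rw [ha, ← pow_succ', pow_succ] at this
    rw [mul_right_cancel this.symm, ha]
  rw [hs, show (2 * (2 * s + 1) + 1) * a = a + 2 * a * (2 * s + 1) by ring, pow_add,
    mul_eq_left, ← orderOf_dvd_iff_pow_eq_one, hx] at h5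
  have h6 : 2 ^ m ∣ 2 * a := by
    refine Nat.Coprime.dvd_of_dvd_mul_right (Nat.Coprime.pow_left m ?_) h5
    exact hp.coprime_iff_not_dvd.2 (by omega)
  obtain ⟨c, hc⟩ := h6
  have hm1 : 2 ^ m = 2 * 2 ^ (m - 1) := by rw [← pow_succ']; congr 1; omega
  have ha' : a = 2 ^ (m - 1) * c := by
    rw [hm1, mul_assoc] at hc
    exact Nat.eq_of_mul_eq_mul_left two_pos hc
  rw [← ha, ha']
  rcases Nat.even_or_odd' c with ⟨d, rfl | rfl⟩
  · left
    rw [show 2 ^ (m - 1) * (2 * d) = 2 ^ m * d by rw [hm1]; ring, pow_mul, ← hx, pow_orderOf_eq_one,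
      one_pow]
  · right
    rw [show 2 ^ (m - 1) * (2 * d + 1) = 2 ^ m * d + 2 ^ (m - 1) by rw [hm1]; ring, pow_add, pow_mul,
      ← hx, pow_orderOf_eq_one, one_pow, one_mul]

theorem card_cyclicSubgroups_of_forall_orderOf_eq_four (hm : 1 ≤ m)
    (hG : Nat.card G = 2 ^ (m + 1)) (hx : orderOf x = 2 ^ m)
    (h : ∀ g, g ∉ zpowers x → orderOf g = 4) :
    Nat.card (cyclicSubgroups G) = m + 1 + 2 ^ (m - 1) := by
  classical
  have := Fintype.ofFinite G
  have hm1 : (2 : ℚ) ^ m = 2 * 2 ^ (m - 1) := by rw [← pow_succ']; congr 1; omega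
  have h1 : (Nat.card (cyclicSubgroups G) : ℚ) = m + 1 + 2 ^ (m - 1) := by
    rw [card_cyclicSubgroups_eq_add_sum Nat.prime_two hx, Finset.sum_congr rfl
      (g := fun _ => (2 : ℚ)⁻¹), Finset.sum_const, card_filter_notMem_zpowers hG hx, nsmul_eq_mul]
    · push_cast
      rw [hm1]; ring
    · intro g hg
      rw [h g (Finset.mem_filter.1 hg).2, show (4 : ℕ) = 2 ^ 2 by rfl, Nat.totient_prime_pow Nat.prime_two two_pos]
      norm_num
  exact_mod_cast h1

/-- The `2 ^ m` outside elements have order dividing `4`, hence weight at least `1/2`. An outside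
involution weighs `1`, so equality leaves none. -/
theorem le_card_cyclicSubgroups_of_conj_not_modEq (hm : 2 ≤ m)
    (hG : Nat.card G = 2 ^ (m + 1)) (hx : orderOf x = 2 ^ m)
    (h : ∀ (y : G) (r : ℕ), y ∉ zpowers x → y * x * y⁻¹ = x ^ r → ¬ r ≡ 1 [MOD 4]) :
    m + 1 + 2 ^ (m - 1) ≤ Nat.card (cyclicSubgroups G) ∧
      (Nat.card (cyclicSubgroups G) = m + 1 + 2 ^ (m - 1) →
        ∀ g, g ∉ zpowers x → g ^ 2 = x ^ 2 ^ (m - 1)) := by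
  classical
  have := Fintype.ofFinite G
  have hm1 : (2 : ℕ) ^ m = 2 * 2 ^ (m - 1) := by rw [← pow_succ']; congr 1; omega
  have hterm : ∀ g ∈ Finset.univ.filter (fun g : G => g ∉ zpowers x),
      (2 : ℚ)⁻¹ ≤ ((orderOf g).totient : ℚ)⁻¹ := by
    intro g hg
    refine inv_anti₀ (totient_orderOf_pos g) ?_
    have h4 : g ^ 4 = 1 := by
      rw [show 4 = 2 * 2 by rfl, pow_mul]
      rcases sq_eq_one_or_of_conj_not_modEq hm hG hx h (Finset.mem_filter.1 hg).2 with h1 | h1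
      · rw [h1, one_pow]
      · rw [h1, ← pow_mul, mul_comm, ← hm1, ← hx, pow_orderOf_eq_one]
    have h5 := Nat.le_of_dvd (by decide) (Nat.totient_dvd_of_dvd (orderOf_dvd_of_pow_eq_one h4))
    exact_mod_cast h5
  have hsum : ∑ g ∈ Finset.univ.filter (fun g : G => g ∉ zpowers x), (2 : ℚ)⁻¹ = 2 ^ (m - 1) := by
    rw [Finset.sum_const, card_filter_notMem_zpowers hG hx, nsmul_eq_mul, hm1]
    push_cast; ring
  have hc := card_cyclicSubgroups_eq_add_sum (G := G) Nat.prime_two hx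
  constructor
  · have := Finset.sum_le_sum hterm
    rw [hsum] at this
    have h1 : ((m + 1 + 2 ^ (m - 1) : ℕ) : ℚ) ≤ Nat.card (cyclicSubgroups G) := by
      push_cast
      linarith
    exact_mod_cast h1
  · intro heq g hg
    rcases sq_eq_one_or_of_conj_not_modEq hm hG hx h hg with h1 | h1
    · exfalso
      have hlt := Finset.sum_lt_sum hterm ⟨g, by simpa using hg, by
        have hle := Nat.le_of_dvd (by decide) (Nat.totient_dvd_of_dvd (orderOf_dvd_of_pow_eq_one h1))
        have hpos := totient_orderOf_pos g
        have hle' : ((orderOf g).totient : ℚ) ≤ 1 := by exact_mod_cast hle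
        have h3 := inv_anti₀ hpos hle'
        rw [inv_one] at h3
        refine lt_of_lt_of_le ?_ h3
        norm_num⟩
      rw [hsum] at hlt
      rw [heq] at hc
      push_cast at hc
      linarith
    · exact h1

theorem two_add_mul_le_card_cyclicSubgroups (hp : p.Prime) (hm : 2 ≤ m) (hm' : p = 2 → 3 ≤ m)
    (hG : Nat.card G = p ^ (m + 1)) (hc : ¬ IsCyclic G) (hx : orderOf x = p ^ m) :
    2 + m * p ≤ Nat.card (cyclicSubgroups G) := by
  rcases exists_split_or_forall_not_modEq hp (by omega) hG hc hx with
    ⟨y, r, hy, hyp, h, hr, hr'⟩ | ⟨rfl, h⟩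
  · exact (card_cyclicSubgroups_of_conj hp hG hx h hr hr' hy hyp).ge
  · refine le_trans ?_ (le_card_cyclicSubgroups_of_conj_not_modEq hm hG hx h).1
    have h3 := hm' rfl
    obtain ⟨k, rfl⟩ : ∃ k, m = k + 3 := ⟨m - 3, by omega⟩
    have h4 : k + 1 ≤ 2 ^ k := Nat.lt_two_pow_self
    rw [show k + 3 - 1 = k + 2 by omega, pow_add]
    omega

end CyclicMaximal

/-! ### Groups of order p^(m+1) without elements of order p^m. -/

section SmallExponent

variable {p m : ℕ}

theorem exists_orderOf_eq_of_dvd {G : Type*} [Group G] [Finite G] {g : G} {d : ℕ}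
    (h : d ∣ orderOf g) : ∃ g' : G, orderOf g' = d := by
  obtain ⟨c, hc⟩ := h
  have h0 : orderOf g ≠ 0 := (orderOf_pos g).ne'
  have hc0 : c ≠ 0 := by rintro rfl; simp [hc] at h0
  refine ⟨g ^ c, ?_⟩
  rw [orderOf_pow_of_dvd hc0 (hc ▸ dvd_mul_left c d), hc,
    Nat.mul_div_cancel _ (Nat.pos_of_ne_zero hc0)]

theorem pow_eq_one_of_forall_orderOf_ne {G : Type*} [Group G] [Finite G] {n : ℕ} (hp : p.Prime)
    (hG : Nat.card G = p ^ n) (h : ∀ g : G, orderOf g ≠ p ^ m) (g : G) : g ^ p ^ (m - 1) = 1 := by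
  obtain ⟨i, -, hi⟩ := orderOf_eq_prime_pow_of_pow_eq_one hp (pow_card_prime_pow hG g)
  have him : i < m := by
    by_contra! hle
    obtain ⟨g', hg'⟩ := exists_orderOf_eq_of_dvd (g := g) (hi ▸ pow_dvd_pow p hle)
    exact h g' hg'
  rw [← orderOf_dvd_iff_pow_eq_one, hi]
  exact pow_dvd_pow p (by omega)

/-- The target grows by `p` from `m` to `m + 1`. The quotient by a central `⟨z⟩` of order `p`
supplies exactly this: `1` from `⟨z⟩` and `p - 1` from the image of another subgroup `⟨t⟩` of order
`p`. Strictness comes from the induction hypothesis or, if the quotient has elements of order `p ^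
m`, from their lifts. -/
theorem lt_card_cyclicSubgroups_succ (hp : p.Prime) (hm : 2 ≤ m) (hm' : p = 2 → 3 ≤ m)
    (ih : ∀ (G : Type u) [Group G] [Finite G], Nat.card G = p ^ (m + 1) →
      (∀ g : G, orderOf g ≠ p ^ m) → 2 + m * p < Nat.card (cyclicSubgroups G))
    (G : Type u) [Group G] [Finite G] (hG : Nat.card G = p ^ (m + 1 + 1))
    (hno : ∀ g : G, orderOf g ≠ p ^ (m + 1)) :
    2 + (m + 1) * p < Nat.card (cyclicSubgroups G) := by
  classical
  have : Fact p.Prime := ⟨hp⟩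
  have hP : IsPGroup p G := IsPGroup.of_card hG
  have : Nontrivial G := hP.nontrivial_iff_card.2 ⟨m + 1 + 1, by omega, hG⟩
  obtain ⟨z, hzc, hz⟩ := exists_central_of_order_prime hp hP
  have hcomm : ∀ a ∈ zpowers z, ∀ g : G, Commute g a := fun a ha g =>
    mem_center_iff.1 (zpowers_le.2 hzc ha) g
  have hZ : (zpowers z).Normal := ⟨fun a ha g => by
    rw [(hcomm a ha g).eq]; simpa using ha⟩
  have hcardZ : Nat.card (zpowers z) = p := by rw [Nat.card_zpowers, hz]
  have := Fintype.ofFinite (G ⧸ zpowers z)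
  have hcardQ : Nat.card (G ⧸ zpowers z) = p ^ (m + 1) := by
    have h1 := Subgroup.card_eq_card_quotient_mul_card_subgroup (zpowers z)
    rw [hG, hcardZ, pow_succ] at h1
    exact (Nat.eq_of_mul_eq_mul_right hp.pos h1).symm
  have hdiv : ∀ g : G, orderOf (g : G ⧸ zpowers z) ∣ orderOf g := fun g =>
    orderOf_map_dvd (QuotientGroup.mk' (zpowers z)) g
  obtain ⟨s, t, hs, ht, hst⟩ : ∃ s t : G, orderOf s = p ∧ orderOf t = p ∧ t ∉ zpowers s := by
    by_contra! h
    obtain ⟨x, hx⟩ := exists_pow_dvd_orderOf_of_unique_subgroup hp (by omega) hG h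
    obtain ⟨x', hx'⟩ := exists_orderOf_eq_of_dvd hx
    exact hno x' hx'
  obtain ⟨t, ht, htZ⟩ : ∃ t : G, orderOf t = p ∧ t ∉ zpowers z := by
    by_contra! h
    have h1 : zpowers s = zpowers z := by
      refine Subgroup.eq_of_le_of_card_ge (zpowers_le.2 (h s hs)) ?_
      rw [Nat.card_zpowers, Nat.card_zpowers, hs, hz]
    exact hst (h1 ▸ h t ht)
  have ht1 : (t : G ⧸ zpowers z) ≠ 1 := fun h => htZ ((QuotientGroup.eq_one_iff t).1 h)
  have htq : orderOf (t : G ⧸ zpowers z) = p := by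
    rcases (Nat.dvd_prime hp).1 (ht ▸ hdiv t) with h | h
    · exact (ht1 (orderOf_eq_one_iff.1 h)).elim
    · exact h
  set F₁ := Finset.univ.filter fun q : G ⧸ zpowers z => zpowers q = zpowers (t : G ⧸ zpowers z)
    with hF₁
  have hF₁' : ∀ q ∈ F₁, q ≠ 1 ∧ ∀ g : G, (g : G ⧸ zpowers z) = q → orderOf g = orderOf q := by
    intro q hq
    have hq' := (Finset.mem_filter.1 hq).2
    have hqp : orderOf q = p := by rw [orderOf_eq_of_zpowers_eq hq', htq]
    have hq1 : q ≠ 1 := by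
      rintro rfl
      rw [orderOf_one] at hqp
      exact hp.one_lt.ne hqp
    refine ⟨hq1, ?_⟩
    rintro g rfl
    rw [hqp]
    obtain ⟨i, hi⟩ : (g : G ⧸ zpowers z) ∈ zpowers (t : G ⧸ zpowers z) := hq' ▸ mem_zpowers _
    simp only [← QuotientGroup.mk_zpow] at hi
    -- Each lift is a power of `t` times a central element of `⟨z⟩`, so its `p`-th power is trivial.
    have ha : (t ^ i)⁻¹ * g ∈ zpowers z := QuotientGroup.eq.1 hi
    have hg : g = t ^ i * ((t ^ i)⁻¹ * g) := by group
    refine orderOf_eq_prime ?_ fun h => hq1 (by rw [h]; rfl)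
    rw [hg, (hcomm _ ha (t ^ i)).mul_pow]
    have h1 : (t ^ i) ^ p = 1 := by
      rw [← zpow_natCast, ← zpow_mul, mul_comm, zpow_mul, zpow_natCast, ← ht, pow_orderOf_eq_one,
        one_zpow]
    have h2 : ((t ^ i)⁻¹ * g) ^ p = 1 := by
      have := pow_card_eq_one' (x := (⟨_, ha⟩ : zpowers z))
      rw [hcardZ] at this
      exact congrArg Subtype.val this
    rw [h1, h2, one_mul]
  by_cases hq : ∃ q : G ⧸ zpowers z, orderOf q = p ^ m
  · obtain ⟨q₀, hq₀⟩ := hq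
    have hnc : ¬ IsCyclic (G ⧸ zpowers z) := by
      rintro ⟨q, hq⟩
      obtain ⟨g, rfl⟩ := QuotientGroup.mk_surjective q
      have h1 := orderOf_eq_card_of_forall_mem_zpowers hq
      rw [hcardQ] at h1
      obtain ⟨g', hg'⟩ := exists_orderOf_eq_of_dvd (h1 ▸ hdiv g)
      exact hno g' hg'
    have hb := two_add_mul_le_card_cyclicSubgroups hp hm hm' hcardQ hnc hq₀
    set F₂ := Finset.univ.filter fun q : G ⧸ zpowers z => zpowers q = zpowers q₀ with hF₂
    -- The exponent of `G` divides `p ^ m`, so lifts of elements of order `p ^ m` cannot have larger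
    -- order. This is a further gain of `p - 1`.
    have hF₂' : ∀ q ∈ F₂, q ≠ 1 ∧ ∀ g : G, (g : G ⧸ zpowers z) = q → orderOf g = orderOf q := by
      intro q hq
      have hqo : orderOf q = p ^ m := by
        rw [orderOf_eq_of_zpowers_eq (Finset.mem_filter.1 hq).2, hq₀]
      refine ⟨?_, ?_⟩
      · rintro rfl
        rw [orderOf_one] at hqo
        exact (Nat.one_lt_pow (by omega) hp.one_lt).ne hqo
      · rintro g rfl
        refine Nat.dvd_antisymm ?_ (hdiv g)
        rw [hqo]
        exact orderOf_dvd_of_pow_eq_one (pow_eq_one_of_forall_orderOf_ne hp hG hno g)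
    have hdisj : Disjoint F₁ F₂ := by
      rw [Finset.disjoint_left]
      intro q h1 h2
      have h3 := orderOf_eq_of_zpowers_eq (Finset.mem_filter.1 h1).2
      have h4 := orderOf_eq_of_zpowers_eq (Finset.mem_filter.1 h2).2
      rw [h3, htq, hq₀] at h4
      have h5 := Nat.pow_right_injective hp.two_le ((pow_one p).trans h4)
      omega
    have hmain := card_cyclicSubgroups_quotient_add_le hp (zpowers z) hcardZ (F₁ ∪ F₂) fun q hq =>
      (Finset.mem_union.1 hq).elim (hF₁' q) (hF₂' q)
    rw [Finset.sum_union hdisj, hF₁, hF₂, sum_filter_zpowers_eq, sum_filter_zpowers_eq] at hmain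
    have hb' : ((2 + m * p : ℕ) : ℚ) ≤ Nat.card (cyclicSubgroups (G ⧸ zpowers z)) := by
      exact_mod_cast hb
    have hp1 : (1 : ℚ) < p := by exact_mod_cast hp.one_lt
    have : ((2 + (m + 1) * p : ℕ) : ℚ) < Nat.card (cyclicSubgroups G) := by
      push_cast at hb' ⊢
      linarith
    exact_mod_cast this
  · push Not at hq
    have hb := ih (G ⧸ zpowers z) hcardQ hq
    have hmain := card_cyclicSubgroups_quotient_add_le hp (zpowers z) hcardZ F₁ hF₁'
    rw [hF₁, sum_filter_zpowers_eq] at hmain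
    have hb' : ((2 + m * p : ℕ) : ℚ) < Nat.card (cyclicSubgroups (G ⧸ zpowers z)) := by
      exact_mod_cast hb
    have : ((2 + (m + 1) * p : ℕ) : ℚ) < Nat.card (cyclicSubgroups G) := by
      push_cast at hb' ⊢
      linarith
    exact_mod_cast this

/-- A group of order `p ^ 3` and exponent dividing `p` has at least `p ^ 2 + p + 2` cyclic
subgroups. -/
theorem le_card_cyclicSubgroups_of_exponent_prime {G : Type*} [Group G] [Finite G] (hp : p.Prime)
    (hG : Nat.card G = p ^ 3) (h : ∀ g : G, g ^ p = 1) :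
    p ^ 2 + p + 2 ≤ Nat.card (cyclicSubgroups G) := by
  have := Fintype.ofFinite G
  have h1 := one_add_le_card_cyclicSubgroups (G := G) (e := 1) hp (by simpa using h)
  have hp1 : (1 : ℚ) < p := by exact_mod_cast hp.one_lt
  have h2 : (p : ℚ) - 1 ≠ 0 := by linarith
  rw [hG, pow_one, Nat.totient_prime hp, Nat.cast_pred hp.pos] at h1
  push_cast at h1
  rw [show (p : ℚ) ^ 3 - 1 = (p ^ 2 + p + 1) * (p - 1) by ring, mul_div_cancel_right₀ _ h2] at h1
  have h3 : ((p ^ 2 + p + 2 : ℕ) : ℚ) ≤ Nat.card (cyclicSubgroups G) := by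
    push_cast; linarith
  exact_mod_cast h3

/-- For `p = 2` the induction starts at order `16`, since the step needs the bound for noncyclic
quotients and `Q_8` violates it. There the exponent divides `4` and the count is at least `1 + 15/2
> 8`. -/
theorem lt_card_cyclicSubgroups_of_forall_orderOf_ne (hp : p.Prime) (hm : 2 ≤ m)
    (hm' : p = 2 → 3 ≤ m) (G : Type u) [Group G] [Finite G] (hG : Nat.card G = p ^ (m + 1))
    (hno : ∀ g : G, orderOf g ≠ p ^ m) : 2 + m * p < Nat.card (cyclicSubgroups G) := by
  by_cases h2 : p = 2
  · subst h2
    have h3 := hm' rfl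
    clear hm hm'
    induction m, h3 using Nat.le_induction generalizing G with
    | base =>
      have := Fintype.ofFinite G
      have h1 := one_add_le_card_cyclicSubgroups (G := G) hp (pow_eq_one_of_forall_orderOf_ne hp hG hno)
      rw [hG, show 3 - 1 = 2 by rfl, Nat.totient_prime_pow hp two_pos] at h1
      generalize Nat.card (cyclicSubgroups G) = c at h1 ⊢
      norm_num at h1 ⊢
      have h2 : ((8 : ℕ) : ℚ) < c := by
        push_cast; linarith
      exact_mod_cast h2
    | succ m hm ih =>
      exact lt_card_cyclicSubgroups_succ hp (by omega) (fun _ => hm)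
        (fun G _ _ hG hno => ih G hG hno) G hG hno
  · clear hm'
    induction m, hm using Nat.le_induction generalizing G with
    | base =>
      have h1 := le_card_cyclicSubgroups_of_exponent_prime hp hG (fun g => by
        simpa using pow_eq_one_of_forall_orderOf_ne hp hG hno g)
      have := hp.two_le
      nlinarith
    | succ m hm ih =>
      exact lt_card_cyclicSubgroups_succ hp hm (fun h => (h2 h).elim)
        (fun G _ _ hG hno => ih G hG hno) G hG hno

end SmallExponent

/-! ### Recognizing the model groups from generators and relations. -/

section Models

variable {G : Type*} [Group G]

/-- The homomorphism from the cyclic group of order `k` sending the generator to `x`. -/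
noncomputable def cyclicGrpHom (k : ℕ) (x : G) (hx : x ^ k = 1) : CyclicGrp k →* G :=
  AddMonoidHom.toMultiplicativeLeft
    (ZMod.lift k ⟨zmultiplesHom (Additive G) (Additive.ofMul x), by
      rw [zmultiplesHom_apply, natCast_zsmul, ← ofMul_pow, hx, ofMul_one]⟩)

theorem cyclicGrpHom_intCast (k : ℕ) (x : G) (hx : x ^ k = 1) (i : ℤ) :
    cyclicGrpHom k x hx (Multiplicative.ofAdd (i : ZMod k)) = x ^ i := by
  show Additive.toMul (ZMod.lift k _ (i : ZMod k)) = x ^ i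
  rw [ZMod.lift_coe]
  rfl

theorem cyclicGrpHom_one (k : ℕ) (x : G) (hx : x ^ k = 1) :
    cyclicGrpHom k x hx (Multiplicative.ofAdd 1) = x := by
  simpa using cyclicGrpHom_intCast k x hx 1

theorem nonempty_mulEquiv_of_surjective {H : Type*} [Group H] [Finite H] (f : H →* G)
    (hf : Function.Surjective f) (hc : Nat.card H = Nat.card G) : Nonempty (G ≃* H) :=
  ⟨(MulEquiv.ofBijective f ((Nat.bijective_iff_surjective_and_card f).2 ⟨hf, hc⟩)).symm⟩

theorem nonempty_mulEquiv_cyclicGrp_iff {k : ℕ} (hG : Nat.card G = k) :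
    Nonempty (G ≃* CyclicGrp k) ↔ IsCyclic G := by
  constructor
  · rintro ⟨e⟩
    exact e.symm.isCyclic.1 inferInstance
  · intro h
    subst hG
    exact ⟨(zmodCyclicMulEquiv h).symm⟩

theorem isNonCyclicOfOrder_iff {p n : ℕ} :
    IsNonCyclicOfOrder p n G ↔ Nat.card G = p ^ n ∧ ¬ IsCyclic G :=
  and_congr_right fun h => by rw [nonempty_mulEquiv_cyclicGrp_iff h]

theorem nonempty_mulEquiv_prod_of_commute {p m : ℕ} {x y : G} (hp : p.Prime)
    (hG : Nat.card G = p ^ (m + 1)) (hx : orderOf x = p ^ m) (hy : y ∉ zpowers x)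
    (hyp : y ^ p = 1) (hxy : Commute y x) :
    Nonempty (G ≃* CyclicGrp p × CyclicGrp (p ^ m)) := by
  have : NeZero p := ⟨hp.ne_zero⟩
  have : NeZero (p ^ m) := ⟨(pow_pos hp.pos m).ne'⟩
  have hx1 : x ^ p ^ m = 1 := hx ▸ pow_orderOf_eq_one x
  let f := MonoidHom.noncommCoprod (cyclicGrpHom p y hyp) (cyclicGrpHom (p ^ m) x hx1) (by
    intro a b
    obtain ⟨i, hi⟩ := ZMod.intCast_surjective a.toAdd
    obtain ⟨j, hj⟩ := ZMod.intCast_surjective b.toAdd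
    have h1 := cyclicGrpHom_intCast p y hyp i
    have h2 := cyclicGrpHom_intCast (p ^ m) x hx1 j
    rw [hi, ofAdd_toAdd] at h1
    rw [hj, ofAdd_toAdd] at h2
    rw [h1, h2]
    exact (hxy.zpow_left i).zpow_right j)
  refine nonempty_mulEquiv_of_surjective f ?_ ?_
  · rw [← MonoidHom.range_eq_top]
    refine eq_top_of_mem_of_notMem hp hG hx ?_ ?_ hy
    · exact ⟨(1, Multiplicative.ofAdd 1), by simp [f, cyclicGrpHom_one]⟩
    · exact ⟨(Multiplicative.ofAdd 1, 1), by simp [f, cyclicGrpHom_one]⟩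
  · rw [hG, Nat.card_prod, pow_succ', Nat.card_congr Multiplicative.toAdd,
      Nat.card_congr Multiplicative.toAdd, Nat.card_zmod, Nat.card_zmod]

theorem nonempty_mulEquiv_quaternionGroup {m : ℕ} {x y : G} (hm : m ≠ 0)
    (hG : Nat.card G = 2 ^ (m + 1)) (hx : orderOf x = 2 ^ m) (hy : y ∉ zpowers x)
    (hy2 : y ^ 2 = x ^ 2 ^ (m - 1)) (hxy : y * x * y⁻¹ = x⁻¹) :
    Nonempty (G ≃* QuaternionGroup (2 ^ (m - 1))) := by
  have hm1 : 2 ^ m = 2 * 2 ^ (m - 1) := by rw [← pow_succ']; congr 1; omega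
  have hx1 : x ^ (2 * 2 ^ (m - 1)) = 1 := by rw [← hm1, ← hx, pow_orderOf_eq_one]
  set k := 2 ^ (m - 1) with hk
  have : NeZero k := ⟨(pow_pos two_pos _).ne'⟩
  let F : ZMod (2 * k) → G := fun i => cyclicGrpHom (2 * k) x hx1 (Multiplicative.ofAdd i)
  have hF : ∀ i : ℤ, F (i : ZMod (2 * k)) = x ^ i := cyclicGrpHom_intCast (2 * k) x hx1
  have hyz : ∀ i : ℤ, x ^ i * y = y * x ^ (-i) := by
    intro i
    have h1 : y * x ^ (-i) * y⁻¹ = x ^ i := by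
      rw [← conj_zpow, hxy, inv_zpow', neg_neg]
    rw [← h1]; group
  -- Here `a i` goes to `x ^ i` and `xa i` to `y * x ^ i`: the letter `x` in the constructor `xa` is
  -- the present `y`.
  let f : QuaternionGroup k →* G := MonoidHom.mk' (fun q => match q with
    | .a i => F i
    | .xa i => y * F i) (by
      have hs := ZMod.intCast_surjective (n := 2 * k)
      rintro (i | i) (j | j) <;> obtain ⟨i, rfl⟩ := hs i <;> obtain ⟨j, rfl⟩ := hs j
      · show F (i + j) = F i * F j
        rw [← Int.cast_add, hF, hF, hF, zpow_add]
      · show y * F (j - i) = F i * (y * F j)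
        rw [← Int.cast_sub, hF, hF, hF, ← mul_assoc, hyz, mul_assoc, ← zpow_add, neg_add_eq_sub]
      · show y * F (i + j) = y * F i * F j
        rw [← Int.cast_add, hF, hF, hF, zpow_add, mul_assoc]
      · show F (k + j - i) = y * F i * (y * F j)
        rw [← Int.cast_natCast k, ← Int.cast_add, ← Int.cast_sub, hF, hF, hF, mul_assoc y,
          ← mul_assoc (x ^ i), hyz, mul_assoc y (x ^ (-i)), ← mul_assoc y y, ← pow_two, hy2,
          ← zpow_natCast, ← zpow_add, ← zpow_add]
        congr 1; ring)
  refine nonempty_mulEquiv_of_surjective f ?_ ?_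
  · rw [← MonoidHom.range_eq_top]
    refine eq_top_of_mem_of_notMem Nat.prime_two hG hx ?_ ?_ hy
    · refine ⟨.a 1, ?_⟩
      show F 1 = x
      simpa using hF 1
    · refine ⟨.xa 0, ?_⟩
      show y * F 0 = y
      have := hF 0
      rw [Int.cast_zero] at this
      rw [this, zpow_zero, mul_one]
  · rw [Nat.card_eq_fintype_card, QuaternionGroup.card, hG, pow_succ, hm1]
    ring

end Models

/-! ### The modular p-group. -/

theorem one_add_pow_of_mul_self_eq_zero {R : Type*} [CommRing R] {a : R} (h : a * a = 0) (k : ℕ) :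
    (1 + a) ^ k = 1 + k * a := by
  induction k with
  | zero => simp
  | succ k ih =>
    rw [pow_succ, ih]
    push_cast
    linear_combination (k : R) * h

theorem one_add_mul_prime_pow_pow {p m : ℕ} (hm : 2 ≤ m) (i k : ℕ) :
    (1 + i * p ^ (m - 1)) ^ k ≡ 1 + k * i * p ^ (m - 1) [MOD p ^ m] := by
  rw [← ZMod.natCast_eq_natCast_iff]
  push_cast
  rw [one_add_pow_of_mul_self_eq_zero, mul_assoc]
  have h : p ^ m ∣ i * p ^ (m - 1) * (i * p ^ (m - 1)) := by
    have : p ^ m ∣ p ^ (m - 1) * p ^ (m - 1) := by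
      rw [← pow_add]; exact pow_dvd_pow p (by omega)
    rw [show i * p ^ (m - 1) * (i * p ^ (m - 1)) = p ^ (m - 1) * p ^ (m - 1) * (i * i) by ring]
    exact this.mul_right _
  exact_mod_cast (ZMod.natCast_eq_zero_iff _ _).2 h

/-- `r ^ p - 1 = (r - 1) * (p * u)` with `p ∤ u`, so `p ^ (m - 1)` divides `r - 1`. -/
theorem exists_eq_one_add_mul_of_pow_prime_modEq {p m r : ℕ} (hp : p.Prime) (hr : r ≡ 1 [MOD p])
    (hr' : p = 2 → r ≡ 1 [MOD 4]) (h : r ^ p ≡ 1 [MOD p ^ m]) :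
    ∃ i, r = 1 + i * p ^ (m - 1) := by
  obtain ⟨u, hu, hpu⟩ := exists_geom_sum_eq_prime_mul hp hr hr'
  have hr1 : 1 ≤ r := by
    by_contra! h0
    obtain rfl : r = 0 := by omega
    have := (Nat.modEq_iff_dvd' (Nat.zero_le 1)).1 hr
    exact hp.one_lt.ne' (Nat.dvd_one.1 (by simpa using this))
  obtain ⟨s, rfl⟩ := Nat.exists_eq_add_of_le hr1
  have h1 : p ^ m ∣ p * (u * s) := by
    have h2 := (Nat.modEq_iff_dvd.1 h.symm)
    push_cast at h2
    have h3 := geom_sum_mul ((1 + s : ℕ) : ℤ) p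
    have h4 : (∑ i ∈ Finset.range p, ((1 + s : ℕ) : ℤ) ^ i) = ((p * u : ℕ) : ℤ) := by
      rw [← hu]; push_cast; rfl
    rw [h4] at h3
    push_cast at h3
    rw [← h3] at h2
    have h5 : ((p ^ m : ℕ) : ℤ) ∣ ((p * (u * s) : ℕ) : ℤ) := by
      push_cast
      convert h2 using 1
      ring
    exact Int.natCast_dvd_natCast.1 h5
  have h6 : p ^ (m - 1) ∣ u * s := by
    rcases Nat.eq_zero_or_pos m with rfl | hm
    · simp
    · rw [show p ^ m = p * p ^ (m - 1) by rw [← pow_succ']; congr 1; omega] at h1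
      exact Nat.dvd_of_mul_dvd_mul_left hp.pos h1
  have h7 : p ^ (m - 1) ∣ s :=
    Nat.Coprime.dvd_of_dvd_mul_left (Nat.Coprime.pow_left _ (hp.coprime_iff_not_dvd.2 hpu)) h6
  obtain ⟨i, rfl⟩ := h7
  exact ⟨i, by rw [mul_comm i]⟩

theorem addRight_one_pow_apply {R : Type*} [Ring R] (k : ℕ) (v : R) :
    ((Equiv.addRight (1 : R) : Equiv.Perm R) ^ k) v = v + k := by
  induction k with
  | zero => simp
  | succ k ih =>
    rw [pow_succ', Equiv.Perm.mul_apply, ih]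
    push_cast
    simp [add_assoc]

namespace ModularPGroup

variable {p m : ℕ}

/-- The generator `x` of `M(p^n)`. -/
def x (p n : ℕ) : ModularPGroup p n := PresentedGroup.of 0

/-- The generator `y` of `M(p^n)`. -/
def y (p n : ℕ) : ModularPGroup p n := PresentedGroup.of 1

theorem x_pow : x p (m + 1) ^ p ^ m = 1 :=
  PresentedGroup.one_of_mem (rels := modularRels p (m + 1)) (.inl rfl)

theorem y_pow : y p (m + 1) ^ p = 1 :=
  PresentedGroup.one_of_mem (rels := modularRels p (m + 1)) (.inr (.inl rfl))

theorem conj_eq : (y p (m + 1))⁻¹ * x p (m + 1) * y p (m + 1) =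
    x p (m + 1) ^ (1 + p ^ (m - 1)) :=
  mul_inv_eq_one.1
    (PresentedGroup.one_of_mem (rels := modularRels p (m + 1)) (.inr (.inr rfl)))

theorem closure_eq_top (n : ℕ) : closure {x p n, y p n} = ⊤ := by
  rw [← PresentedGroup.closure_range_of]
  congr 1
  ext g
  simp only [Set.mem_insert_iff, Set.mem_singleton_iff, Set.mem_range, Fin.exists_fin_two, x, y,
    eq_comm]

/-- The homomorphism out of `M(p^n)` given by elements satisfying the defining relations. -/
theorem exists_hom {G : Type*} [Group G] {a b : G} (ha : a ^ p ^ m = 1) (hb : b ^ p = 1)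
    (hab : b⁻¹ * a * b = a ^ (1 + p ^ (m - 1))) :
    ∃ f : ModularPGroup p (m + 1) →* G, f (x p (m + 1)) = a ∧ f (y p (m + 1)) = b := by
  have hrel : ∀ r ∈ modularRels p (m + 1), FreeGroup.lift ![a, b] r = 1 := by
    rintro r (rfl | rfl | rfl)
    · simpa using ha
    · simpa using hb
    · simp only [map_mul, map_inv, map_pow, FreeGroup.lift_apply_of, Matrix.cons_val_zero,
        Matrix.cons_val_one]
      rw [hab]
      exact mul_inv_cancel _
  exact ⟨PresentedGroup.toGroup hrel, PresentedGroup.toGroup.of hrel, PresentedGroup.toGroup.of hrel⟩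

/-- The affine maps `v ↦ v + 1` and `v ↦ (1 + p ^ (m - 1))⁻¹ v` of `ℤ / p ^ m` satisfy the
relations of `M(p ^ (m + 1))`. -/
theorem exists_hom_perm (hp : p.Prime) (hm : 2 ≤ m) :
    ∃ f : ModularPGroup p (m + 1) →* Equiv.Perm (ZMod (p ^ m)),
      f (x p (m + 1)) = Equiv.addRight 1 ∧ f (y p (m + 1)) 0 = 0 ∧ f (y p (m + 1)) ≠ 1 := by
  have hs : ((1 + p ^ (m - 1) : ℕ) : ZMod (p ^ m)) ^ p = 1 := by
    have h := one_add_mul_prime_pow_pow (p := p) hm 1 p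
    rw [← ZMod.natCast_eq_natCast_iff] at h
    rw [one_mul, mul_one, ← pow_succ', show m - 1 + 1 = m by omega] at h
    push_cast at h ⊢
    rw [h]
    have : ((p ^ m : ℕ) : ZMod (p ^ m)) = 0 := ZMod.natCast_self _
    push_cast at this
    rw [this, add_zero]
  obtain ⟨u, hu⟩ := IsUnit.of_pow_eq_one hs hp.ne_zero
  have hup : u ^ p = 1 := Units.ext (by rw [Units.val_pow_eq_pow_val, hu, hs, Units.val_one])
  let φ := MulAction.toPermHom (ZMod (p ^ m))ˣ (ZMod (p ^ m))
  -- The inverse of `u` appears because the relation conjugates by `y⁻¹` on the left: multiplication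
  -- by `u` turns translation by `1` into translation by `u`.
  obtain ⟨f, hfx, hfy⟩ := exists_hom (p := p) (m := m)
    (a := (Equiv.addRight 1 : Equiv.Perm (ZMod (p ^ m)))) (b := φ u⁻¹)
    (by ext v; rw [addRight_one_pow_apply, ZMod.natCast_self, add_zero]; rfl)
    (by rw [← map_pow, inv_pow, hup, inv_one, map_one])
    (by
      ext v
      rw [addRight_one_pow_apply, ← map_inv, inv_inv]
      show (u : ZMod (p ^ m)) * ((u⁻¹ : (ZMod (p ^ m))ˣ) * v + 1) = v + _
      rw [mul_add, Units.mul_inv_cancel_left, hu, mul_one])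
  refine ⟨f, hfx, ?_, ?_⟩
  · rw [hfy]
    exact smul_zero (u⁻¹ : (ZMod (p ^ m))ˣ)
  · rw [hfy, map_inv, Ne, inv_eq_one]
    intro h
    have h1 : (u : ZMod (p ^ m)) * 1 = 1 := congrArg (fun e : Equiv.Perm _ => e 1) h
    rw [mul_one, hu] at h1
    have h2 : ((p ^ (m - 1) : ℕ) : ZMod (p ^ m)) = 0 := by
      push_cast at h1 ⊢
      simpa using h1
    have h3 := (Nat.pow_dvd_pow_iff_le_right hp.one_lt).1 ((ZMod.natCast_eq_zero_iff _ _).1 h2)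
    omega

theorem orderOf_x (hp : p.Prime) (hm : 2 ≤ m) : orderOf (x p (m + 1)) = p ^ m := by
  obtain ⟨f, hfx, -, -⟩ := exists_hom_perm hp hm
  refine Nat.dvd_antisymm (orderOf_dvd_of_pow_eq_one x_pow) ?_
  have h : f (x p (m + 1) ^ orderOf (x p (m + 1))) 0 = 0 := by
    rw [pow_orderOf_eq_one, map_one]; rfl
  rw [map_pow, hfx, addRight_one_pow_apply, zero_add] at h
  exact (ZMod.natCast_eq_zero_iff _ _).1 h

/-- In the affine representation `y` fixes `0` without being trivial, whereas a translation fixing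
`0` is trivial. -/
theorem y_notMem_zpowers (hp : p.Prime) (hm : 2 ≤ m) : y p (m + 1) ∉ zpowers (x p (m + 1)) := by
  obtain ⟨f, hfx, hfy, hfy'⟩ := exists_hom_perm hp hm
  intro h
  have hfin : IsOfFinOrder (x p (m + 1)) :=
    isOfFinOrder_iff_pow_eq_one.2 ⟨p ^ m, pow_pos hp.pos m, x_pow⟩
  obtain ⟨k, hk⟩ := hfin.mem_powers_iff_mem_zpowers.2 h
  simp only at hk
  rw [← hk, map_pow, hfx, addRight_one_pow_apply, zero_add, ZMod.natCast_eq_zero_iff] at hfy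
  obtain ⟨c, rfl⟩ := hfy
  rw [pow_mul, x_pow, one_pow] at hk
  exact hfy' (by rw [← hk, map_one])

/-- The relations make `⟨x⟩` normal with `⟨x⟩⟨y⟩` everything; the affine representation prevents any
collapse, so `⟨y⟩` is a complement of order `p`. -/
theorem card_eq (hp : p.Prime) (hm : 2 ≤ m) : Nat.card (ModularPGroup p (m + 1)) = p ^ (m + 1) := by
  have : Fact p.Prime := ⟨hp⟩
  have hx := orderOf_x (p := p) hp hm
  have hy := y_notMem_zpowers (p := p) hp hm
  have hfin : Finite (zpowers (x p (m + 1))) := by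
    refine Nat.finite_of_card_ne_zero ?_
    rw [Nat.card_zpowers, hx]
    exact (pow_pos hp.pos m).ne'
  have hnorm : (zpowers (x p (m + 1))).Normal := by
    rw [← normalizer_eq_top_iff, eq_top_iff, ← closure_eq_top, closure_le]
    rintro g (rfl | rfl)
    · exact le_normalizer (mem_zpowers _)
    · rw [SetLike.mem_coe, ← inv_mem_iff]
      refine mem_normalizer_fintype ?_
      rintro _ ⟨k, rfl⟩
      simp only
      rw [← conj_zpow, inv_inv, conj_eq]
      exact zpow_mem (pow_mem (mem_zpowers _) _) k
  have hdisj : Disjoint (zpowers (x p (m + 1))) (zpowers (y p (m + 1))) := by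
    rw [disjoint_def]
    intro g hgx hgy
    have hfin' : IsOfFinOrder (y p (m + 1)) :=
      isOfFinOrder_iff_pow_eq_one.2 ⟨p, hp.pos, y_pow⟩
    obtain ⟨j, rfl⟩ := hfin'.mem_powers_iff_mem_zpowers.2 hgy
    by_cases hj : p ∣ j
    · obtain ⟨c, rfl⟩ := hj
      simp only
      rw [pow_mul, y_pow, one_pow]
    · exact (pow_notMem_zpowers hp hy y_pow hj hgx).elim
  have hmul : (zpowers (x p (m + 1)) : Set (ModularPGroup p (m + 1))) *
      (zpowers (y p (m + 1)) : Set (ModularPGroup p (m + 1))) = Set.univ := by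
    rw [← normal_mul, ← coe_top, SetLike.coe_set_eq, eq_top_iff, ← closure_eq_top, closure_le]
    rintro g (rfl | rfl)
    · exact mem_sup_left (mem_zpowers _)
    · exact mem_sup_right (mem_zpowers _)
  rw [← (isComplement'_of_disjoint_and_mul_eq_univ hdisj hmul).card_mul_card, Nat.card_zpowers,
    Nat.card_zpowers, hx, orderOf_eq_prime y_pow fun h => hy (h ▸ one_mem _), pow_succ]

theorem finite (hp : p.Prime) (hm : 2 ≤ m) : Finite (ModularPGroup p (m + 1)) :=
  Nat.finite_of_card_ne_zero (by rw [card_eq hp hm]; exact (pow_pos hp.pos _).ne')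

theorem one_add_pow_modEq_one (hm : 2 ≤ m) : 1 + p ^ (m - 1) ≡ 1 [MOD p] := by
  have h : p ^ (m - 1) ≡ 0 [MOD p] := (Nat.modEq_zero_iff_dvd).2 (dvd_pow_self p (by omega))
  simpa using h.add_left 1

theorem isNonCyclicOfOrder (hp : p.Prime) (hm : 2 ≤ m) :
    IsNonCyclicOfOrder p (m + 1) (ModularPGroup p (m + 1)) := by
  have := finite (p := p) hp hm
  exact isNonCyclicOfOrder_iff.2 ⟨card_eq hp hm,
    not_isCyclic_of_pow_eq_one hp (by omega) (orderOf_x hp hm) (y_notMem_zpowers hp hm) y_pow⟩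

theorem card_cyclicSubgroups (hp : p.Prime) (hm : 2 ≤ m) (hm' : p = 2 → 3 ≤ m) :
    Nat.card (cyclicSubgroups (ModularPGroup p (m + 1))) = 2 + m * p := by
  have := finite (p := p) hp hm
  refine card_cyclicSubgroups_of_conj (y := (y p (m + 1))⁻¹) hp (card_eq hp hm) (orderOf_x hp hm)
    (by rw [inv_inv, conj_eq]) (one_add_pow_modEq_one hm) ?_
    (fun h => y_notMem_zpowers hp hm (inv_mem_iff.1 h)) (by rw [inv_pow, y_pow, inv_one])
  rintro rfl
  have h3 := hm' rfl
  have h : 2 ^ (m - 1) ≡ 0 [MOD 4] := (Nat.modEq_zero_iff_dvd).2 (pow_dvd_pow 2 (by omega) : 2 ^ 2 ∣ _)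
  simpa using h.add_left 1

theorem nonempty_mulEquiv {G : Type*} [Group G] {a b : G} (hp : p.Prime) (hm : 2 ≤ m)
    (hG : Nat.card G = p ^ (m + 1)) (ha : orderOf a = p ^ m) (hb : b ∉ zpowers a)
    (hbp : b ^ p = 1) (hab : b⁻¹ * a * b = a ^ (1 + p ^ (m - 1))) :
    Nonempty (G ≃* ModularPGroup p (m + 1)) := by
  have := finite (p := p) hp hm
  obtain ⟨f, hfx, hfy⟩ := exists_hom (p := p) (m := m) (ha ▸ pow_orderOf_eq_one a) hbp hab
  refine nonempty_mulEquiv_of_surjective f ?_ (by rw [hG, card_eq hp hm])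
  rw [← MonoidHom.range_eq_top]
  exact eq_top_of_mem_of_notMem hp hG ha ⟨_, hfx⟩ ⟨_, hfy⟩ hb

end ModularPGroup

/-- The exponent is `r = 1 + i * p ^ (m - 1)`. If `p ∣ i` the action is trivial; otherwise a power
`y ^ k` with `k * i ≡ 1` mod `p` acts by `1 + p ^ (m - 1)`, and its inverse is the generator
required by the presentation. -/
theorem nonempty_mulEquiv_prod_or_modularPGroup {G : Type*} [Group G] {p m r : ℕ} {x y : G}
    (hp : p.Prime) (hm : 2 ≤ m) (hG : Nat.card G = p ^ (m + 1)) (hx : orderOf x = p ^ m)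
    (h : y * x * y⁻¹ = x ^ r) (hr : r ≡ 1 [MOD p]) (hr' : p = 2 → r ≡ 1 [MOD 4])
    (hy : y ∉ zpowers x) (hyp : y ^ p = 1) :
    Nonempty (G ≃* CyclicGrp p × CyclicGrp (p ^ m)) ∨ Nonempty (G ≃* ModularPGroup p (m + 1)) := by
  obtain ⟨i, rfl⟩ := exists_eq_one_add_mul_of_pow_prime_modEq hp hr hr'
    (modEq_of_conj_of_pow_mem hx h (hyp ▸ one_mem _))
  by_cases hpi : p ∣ i
  · left
    refine nonempty_mulEquiv_prod_of_commute hp hG hx hy hyp ?_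
    obtain ⟨c, rfl⟩ := hpi
    have h1 : x ^ (1 + p * c * p ^ (m - 1)) = x := by
      rw [show 1 + p * c * p ^ (m - 1) = 1 + p ^ m * c by
        rw [mul_right_comm, ← pow_succ']; congr 3; omega, pow_add, pow_mul, ← hx,
        pow_orderOf_eq_one, one_pow, mul_one, pow_one]
    rw [h1] at h
    exact mul_inv_eq_iff_eq_mul.1 h
  · right
    obtain ⟨k, hk⟩ : ∃ k, k * i ≡ 1 [MOD p] := by
      obtain ⟨k, -, hk⟩ := Nat.exists_mul_mod_eq_one_of_coprime
        (hp.coprime_iff_not_dvd.2 hpi).symm hp.one_lt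
      refine ⟨k, ?_⟩
      rw [Nat.ModEq, mul_comm, hk, Nat.mod_eq_of_lt hp.one_lt]
    have hpk : ¬ p ∣ k := by
      rintro ⟨c, rfl⟩
      have h0 : p * c * i ≡ 0 [MOD p] := Nat.modEq_zero_iff_dvd.2 ⟨c * i, by ring⟩
      have := Nat.modEq_zero_iff_dvd.1 (hk.symm.trans h0)
      exact hp.one_lt.ne' (Nat.dvd_one.1 this)
    refine ModularPGroup.nonempty_mulEquiv (b := (y ^ k)⁻¹) hp hm hG hx
      (fun h1 => pow_notMem_zpowers hp hy hyp hpk (inv_mem_iff.1 h1)) ?_ ?_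
    · rw [inv_pow, ← pow_mul, mul_comm, pow_mul, hyp, one_pow, inv_one]
    · rw [inv_inv, conj_pow_pow h, pow_eq_pow_iff_modEq, hx]
      refine (one_add_mul_prime_pow_pow hm i k).trans ?_
      refine Nat.ModEq.add_left 1 ?_
      have := hk.mul_right' (p ^ (m - 1))
      rwa [one_mul, ← pow_succ', show m - 1 + 1 = m by omega] at this

/-! ### Cyclic subgroup counts of the abelian and quaternion models. -/

namespace CyclicGrp

theorem card_eq (k : ℕ) : Nat.card (CyclicGrp k) = k := by
  rw [Nat.card_congr Multiplicative.toAdd, Nat.card_zmod]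

theorem card_cyclicSubgroups {p n : ℕ} (hp : p.Prime) :
    Nat.card (cyclicSubgroups (CyclicGrp (p ^ n))) = n + 1 := by
  have : NeZero (p ^ n) := ⟨(pow_pos hp.pos n).ne'⟩
  have : Finite (CyclicGrp (p ^ n)) := Finite.of_equiv _ Multiplicative.ofAdd
  rw [card_cyclicSubgroups_of_isCyclic, card_eq, Nat.divisors_prime_pow hp, Finset.card_map,
    Finset.card_range]

theorem card_prod (p m : ℕ) : Nat.card (CyclicGrp p × CyclicGrp (p ^ m)) = p ^ (m + 1) := by
  rw [Nat.card_prod, card_eq, card_eq, pow_succ']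

theorem orderOf_ofAdd_one (k : ℕ) : orderOf (Multiplicative.ofAdd 1 : CyclicGrp k) = k := by
  rw [orderOf_ofAdd_eq_addOrderOf, ZMod.addOrderOf_one]

theorem orderOf_prod_generator (p m : ℕ) :
    orderOf ((1, Multiplicative.ofAdd 1) : CyclicGrp p × CyclicGrp (p ^ m)) = p ^ m := by
  rw [Prod.orderOf, orderOf_one, orderOf_ofAdd_one, Nat.lcm_one_left]

theorem prod_notMem_zpowers {p : ℕ} (hp : p.Prime) (m : ℕ) :
    ((Multiplicative.ofAdd 1, 1) : CyclicGrp p × CyclicGrp (p ^ m)) ∉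
      zpowers ((1, Multiplicative.ofAdd 1) : CyclicGrp p × CyclicGrp (p ^ m)) := by
  rintro ⟨k, hk⟩
  have h1 : (1 : CyclicGrp p) ^ k = Multiplicative.ofAdd 1 := congrArg Prod.fst hk
  rw [one_zpow] at h1
  have h2 := orderOf_ofAdd_one p
  rw [← h1, orderOf_one] at h2
  exact hp.one_lt.ne h2

theorem prod_pow (p m : ℕ) :
    ((Multiplicative.ofAdd 1, 1) : CyclicGrp p × CyclicGrp (p ^ m)) ^ p = 1 := by
  refine Prod.ext ?_ (one_pow _)
  exact orderOf_dvd_iff_pow_eq_one.1 (orderOf_ofAdd_one p).dvd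

theorem finite_prod {p : ℕ} (hp : p.Prime) (m : ℕ) : Finite (CyclicGrp p × CyclicGrp (p ^ m)) :=
  Nat.finite_of_card_ne_zero (by rw [card_prod]; exact (pow_pos hp.pos _).ne')

theorem isNonCyclicOfOrder_prod {p m : ℕ} (hp : p.Prime) (hm : m ≠ 0) :
    IsNonCyclicOfOrder p (m + 1) (CyclicGrp p × CyclicGrp (p ^ m)) := by
  have := finite_prod hp m
  exact isNonCyclicOfOrder_iff.2 ⟨card_prod p m, not_isCyclic_of_pow_eq_one hp hm
    (orderOf_prod_generator p m) (prod_notMem_zpowers hp m) (prod_pow p m)⟩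

theorem card_cyclicSubgroups_prod {p : ℕ} (hp : p.Prime) (m : ℕ) :
    Nat.card (cyclicSubgroups (CyclicGrp p × CyclicGrp (p ^ m))) = 2 + m * p := by
  have := finite_prod hp m
  refine card_cyclicSubgroups_of_conj (r := 1) hp (card_prod p m) (orderOf_prod_generator p m)
    ?_ rfl (fun _ => rfl) (prod_notMem_zpowers hp m) (prod_pow p m)
  rw [mul_comm, inv_mul_cancel_left, pow_one]

end CyclicGrp

namespace QuaternionGroup

variable {m : ℕ}

theorem natCard_two_pow (hm : m ≠ 0) : Nat.card (QuaternionGroup (2 ^ (m - 1))) = 2 ^ (m + 1) := by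
  rw [Nat.card_eq_fintype_card, QuaternionGroup.card, show 4 = 2 ^ 2 by rfl, ← pow_add]
  congr 1; omega

theorem orderOf_a_one_two_pow (hm : m ≠ 0) :
    orderOf (a 1 : QuaternionGroup (2 ^ (m - 1))) = 2 ^ m := by
  rw [orderOf_a_one, ← pow_succ']
  congr 1; omega

theorem orderOf_eq_four_of_notMem (g : QuaternionGroup (2 ^ (m - 1)))
    (hg : g ∉ zpowers (a 1)) : orderOf g = 4 := by
  rcases g with i | i
  · refine (hg ?_).elim
    rw [← ZMod.natCast_zmod_val i, ← a_one_pow]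
    exact pow_mem (mem_zpowers _) _
  · exact orderOf_xa i

theorem card_cyclicSubgroups (hm : m ≠ 0) :
    Nat.card (cyclicSubgroups (QuaternionGroup (2 ^ (m - 1)))) = m + 1 + 2 ^ (m - 1) :=
  card_cyclicSubgroups_of_forall_orderOf_eq_four (by omega) (natCard_two_pow hm)
    (orderOf_a_one_two_pow hm) orderOf_eq_four_of_notMem

theorem isNonCyclicOfOrder (hm : 2 ≤ m) :
    IsNonCyclicOfOrder 2 (m + 1) (QuaternionGroup (2 ^ (m - 1))) := by
  refine isNonCyclicOfOrder_iff.2 ⟨natCard_two_pow (by omega), fun hc => ?_⟩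
  have h1 := card_cyclicSubgroups_of_isCyclic (G := QuaternionGroup (2 ^ (m - 1)))
  rw [card_cyclicSubgroups (by omega), natCard_two_pow (by omega),
    Nat.divisors_prime_pow Nat.prime_two, Finset.card_map, Finset.card_range] at h1
  have h2 := Nat.pow_le_pow_right two_pos (show 1 ≤ m - 1 by omega)
  omega

end QuaternionGroup

/-! ### From counts to ratios, and the classification. -/

theorem alphaRatio_le_alphaRatio_iff {G H : Type*} [Group G] [Group H] [Finite G]
    (h : Nat.card G = Nat.card H) :
    alphaRatio G ≤ alphaRatio H ↔
      Nat.card (cyclicSubgroups G) ≤ Nat.card (cyclicSubgroups H) := by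
  have h0 : (0 : ℚ) < Nat.card H := by rw [← h]; exact_mod_cast Nat.card_pos
  rw [alphaRatio, alphaRatio, h, div_le_div_iff_of_pos_right h0, Nat.cast_le]

theorem alphaRatio_eq_alphaRatio_iff {G H : Type*} [Group G] [Group H] [Finite G]
    (h : Nat.card G = Nat.card H) :
    alphaRatio G = alphaRatio H ↔
      Nat.card (cyclicSubgroups G) = Nat.card (cyclicSubgroups H) := by
  have := Nat.finite_of_card_ne_zero (α := H) (h ▸ Nat.card_pos.ne')
  rw [le_antisymm_iff, alphaRatio_le_alphaRatio_iff h, alphaRatio_le_alphaRatio_iff h.symm,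
    ← le_antisymm_iff]

theorem alphaRatio_lt_alphaRatio_iff {G H : Type*} [Group G] [Group H] [Finite G]
    (h : Nat.card G = Nat.card H) :
    alphaRatio G < alphaRatio H ↔
      Nat.card (cyclicSubgroups G) < Nat.card (cyclicSubgroups H) := by
  have := Nat.finite_of_card_ne_zero (α := H) (h ▸ Nat.card_pos.ne')
  rw [← not_le, alphaRatio_le_alphaRatio_iff h.symm, not_le]

theorem finite_of_card_eq_prime_pow {G : Type*} {p n : ℕ} (hp : p.Prime)
    (hG : Nat.card G = p ^ n) : Finite G :=
  Nat.finite_of_card_ne_zero (hG ▸ (pow_pos hp.pos n).ne')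

/-- Both `y` and `x * y` lie outside `⟨x⟩`, so their squares agree; cancelling in `x * y * x * y = y
* y` shows that `y` inverts `x`. -/
theorem nonempty_mulEquiv_quaternionGroup_of_sq {G : Type*} [Group G] {m : ℕ} {x : G}
    (hm : m ≠ 0) (hG : Nat.card G = 2 ^ (m + 1)) (hx : orderOf x = 2 ^ m)
    (h : ∀ g, g ∉ zpowers x → g ^ 2 = x ^ 2 ^ (m - 1)) :
    Nonempty (G ≃* QuaternionGroup (2 ^ (m - 1))) := by
  obtain ⟨y, hy⟩ := exists_notMem_zpowers Nat.prime_two hG hx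
  have h1 := h y hy
  have h2 := h (x * y) fun hxy => hy ((Subgroup.mul_mem_cancel_left _ (mem_zpowers x)).1 hxy)
  refine nonempty_mulEquiv_quaternionGroup hm hG hx hy h1 ?_
  rw [← h1, pow_two, pow_two, ← mul_assoc, mul_left_inj, mul_assoc] at h2
  rw [mul_inv_eq_iff_eq_mul]
  exact eq_inv_mul_of_mul_eq h2

/-- The lower bound for the number of cyclic subgroups of a noncyclic group of order `p ^ (m + 1)`,
other than `8`, together with the groups attaining it. -/
theorem card_cyclicSubgroups_lower_bound {G : Type u} [Group G] {p m : ℕ} (hp : p.Prime)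
    (hm : 2 ≤ m) (hm' : p = 2 → 3 ≤ m) (hG : IsNonCyclicOfOrder p (m + 1) G) :
    2 + m * p ≤ Nat.card (cyclicSubgroups G) ∧
      (Nat.card (cyclicSubgroups G) = 2 + m * p →
        Nonempty (G ≃* CyclicGrp p × CyclicGrp (p ^ m)) ∨
        Nonempty (G ≃* ModularPGroup p (m + 1)) ∨
        (p = 2 ∧ m = 3 ∧ Nonempty (G ≃* QuaternionGroup (2 ^ (m - 1))))) := by
  obtain ⟨hcard, hc⟩ := isNonCyclicOfOrder_iff.1 hG
  have := finite_of_card_eq_prime_pow hp hcard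
  by_cases hex : ∃ x : G, orderOf x = p ^ m
  · obtain ⟨x, hx⟩ := hex
    refine ⟨two_add_mul_le_card_cyclicSubgroups hp hm hm' hcard hc hx, fun heq => ?_⟩
    rcases exists_split_or_forall_not_modEq hp (by omega) hcard hc hx with
      ⟨y, r, hy, hyp, h, hr, hr'⟩ | ⟨rfl, h⟩
    · rw [← or_assoc]
      exact .inl (nonempty_mulEquiv_prod_or_modularPGroup hp hm hcard hx h hr hr' hy hyp)
    · obtain ⟨hle, himp⟩ := le_card_cyclicSubgroups_of_conj_not_modEq hm hcard hx h
      have h3 := hm' rfl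
      -- With `m = k + 3`, the inequality `m + 1 + 2 ^ (m - 1) ≤ 2 + 2m` and `k + 1 ≤ 2 ^ k` leave
      -- only `k = 0`.
      have hm3 : m = 3 := by
        obtain ⟨k, rfl⟩ : ∃ k, m = k + 3 := ⟨m - 3, by omega⟩
        rw [heq, show k + 3 - 1 = k + 2 by omega, pow_add] at hle
        have h4 : k + 1 ≤ 2 ^ k := Nat.lt_two_pow_self
        omega
      subst hm3
      exact .inr (.inr ⟨rfl, rfl, nonempty_mulEquiv_quaternionGroup_of_sq (by omega) hcard hx
        (himp heq)⟩)
  · push Not at hex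
    have hlt := lt_card_cyclicSubgroups_of_forall_orderOf_ne hp hm hm' G hcard hex
    exact ⟨hlt.le, fun heq => (hlt.ne' heq).elim⟩

/-- The split groups have `6` cyclic subgroups and exponent `2` gives at least `8`, so only the
quaternion type can reach `5`. -/
theorem card_cyclicSubgroups_lower_bound_eight {G : Type u} [Group G]
    (hG : IsNonCyclicOfOrder 2 3 G) :
    5 ≤ Nat.card (cyclicSubgroups G) ∧
      (Nat.card (cyclicSubgroups G) = 5 → Nonempty (G ≃* QuaternionGroup 2)) := by
  have hp := Nat.prime_two
  obtain ⟨hcard, hc⟩ := isNonCyclicOfOrder_iff.1 hG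
  have := finite_of_card_eq_prime_pow hp hcard
  by_cases hex : ∃ x : G, orderOf x = 2 ^ 2
  · obtain ⟨x, hx⟩ := hex
    rcases exists_split_or_forall_not_modEq hp two_ne_zero hcard hc hx with
      ⟨y, r, hy, hyp, h, hr, hr'⟩ | ⟨-, h⟩
    · rw [card_cyclicSubgroups_of_conj hp hcard hx h hr hr' hy hyp]
      omega
    · obtain ⟨hle, himp⟩ := le_card_cyclicSubgroups_of_conj_not_modEq le_rfl hcard hx h
      exact ⟨hle, fun heq =>
        nonempty_mulEquiv_quaternionGroup_of_sq two_ne_zero hcard hx (himp heq)⟩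
  · push Not at hex
    have h1 := le_card_cyclicSubgroups_of_exponent_prime hp hcard fun g => by
      simpa using pow_eq_one_of_forall_orderOf_ne hp hcard hex g
    omega

/-- The part of the classification common to all cases: properties of the two minimum points
`C_p × C_{p^m}` and `M(p^(m+1))`. -/
theorem minimum_points {p m : ℕ} (hp : p.Prime) (hm : 2 ≤ m) (hm' : p = 2 → 3 ≤ m) :
    IsNonCyclicOfOrder p (m + 1) (CyclicGrp p × CyclicGrp (p ^ m)) ∧
    IsNonCyclicOfOrder p (m + 1) (ModularPGroup p (m + 1)) ∧
    alphaRatio (CyclicGrp p × CyclicGrp (p ^ m)) = alphaRatio (ModularPGroup p (m + 1)) ∧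
    alphaRatio (CyclicGrp (p ^ (m + 1))) < alphaRatio (CyclicGrp p × CyclicGrp (p ^ m)) := by
  have := CyclicGrp.finite_prod hp m
  have : Finite (CyclicGrp (p ^ (m + 1))) := finite_of_card_eq_prime_pow hp (CyclicGrp.card_eq _)
  refine ⟨CyclicGrp.isNonCyclicOfOrder_prod hp (by omega), ModularPGroup.isNonCyclicOfOrder hp hm,
    ?_, ?_⟩
  · rw [alphaRatio_eq_alphaRatio_iff (by rw [CyclicGrp.card_prod, ModularPGroup.card_eq hp hm]),
      CyclicGrp.card_cyclicSubgroups_prod hp, ModularPGroup.card_cyclicSubgroups hp hm hm']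
  · rw [alphaRatio_lt_alphaRatio_iff (by rw [CyclicGrp.card_prod, CyclicGrp.card_eq]),
      CyclicGrp.card_cyclicSubgroups_prod hp, CyclicGrp.card_cyclicSubgroups hp]
    have := Nat.mul_le_mul_left m hp.two_le
    omega

theorem alphaRatio_prod_le {G : Type u} [Group G] {p m : ℕ} (hp : p.Prime)
    (hm : 2 ≤ m) (hm' : p = 2 → 3 ≤ m) (hG : IsNonCyclicOfOrder p (m + 1) G) :
    alphaRatio (CyclicGrp p × CyclicGrp (p ^ m)) ≤ alphaRatio G ∧
      (alphaRatio G = alphaRatio (CyclicGrp p × CyclicGrp (p ^ m)) →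
        Nonempty (G ≃* CyclicGrp p × CyclicGrp (p ^ m)) ∨
        Nonempty (G ≃* ModularPGroup p (m + 1)) ∨
        (p = 2 ∧ m = 3 ∧ Nonempty (G ≃* QuaternionGroup (2 ^ (m - 1))))) := by
  have := CyclicGrp.finite_prod hp m
  have := finite_of_card_eq_prime_pow hp hG.1
  obtain ⟨hle, himp⟩ := card_cyclicSubgroups_lower_bound hp hm hm' hG
  rw [alphaRatio_le_alphaRatio_iff (by rw [CyclicGrp.card_prod, hG.1]),
    alphaRatio_eq_alphaRatio_iff (by rw [CyclicGrp.card_prod, hG.1]),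
    CyclicGrp.card_cyclicSubgroups_prod hp]
  exact ⟨hle, himp⟩

theorem alphaRatio_quaternionGroup_four :
    alphaRatio (ModularPGroup 2 4) = alphaRatio (QuaternionGroup 4) := by
  have hp := Nat.prime_two
  have := ModularPGroup.finite (m := 3) hp (by omega)
  have h1 : Nat.card (QuaternionGroup 4) = 2 ^ 4 := QuaternionGroup.natCard_two_pow (m := 3) (by omega)
  have h2 : Nat.card (cyclicSubgroups (QuaternionGroup 4)) = 8 :=
    QuaternionGroup.card_cyclicSubgroups (m := 3) (by omega)
  have h3 : Nat.card (ModularPGroup 2 4) = 2 ^ 4 := ModularPGroup.card_eq (m := 3) hp (by omega)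
  have h4 : Nat.card (cyclicSubgroups (ModularPGroup 2 4)) = 8 :=
    ModularPGroup.card_cyclicSubgroups (m := 3) hp (by omega) (fun _ => le_rfl)
  rw [alphaRatio_eq_alphaRatio_iff (by rw [h1, h3]), h2, h4]

theorem theorem2p3 (p n : ℕ) (hp : p.Prime) (hn : 3 ≤ n) :
    -- `p` odd
    (p ≠ 2 →
      IsNonCyclicOfOrder p n (CyclicGrp p × CyclicGrp (p ^ (n - 1))) ∧
      IsNonCyclicOfOrder p n (ModularPGroup p n) ∧
      alphaRatio (CyclicGrp p × CyclicGrp (p ^ (n - 1))) = alphaRatio (ModularPGroup p n) ∧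
      alphaRatio (CyclicGrp (p ^ n)) < alphaRatio (CyclicGrp p × CyclicGrp (p ^ (n - 1))) ∧
      ∀ (G : Type u) [Group G], IsNonCyclicOfOrder p n G →
        alphaRatio (CyclicGrp p × CyclicGrp (p ^ (n - 1))) ≤ alphaRatio G ∧
        (alphaRatio G = alphaRatio (CyclicGrp p × CyclicGrp (p ^ (n - 1))) ↔
          Nonempty (G ≃* CyclicGrp p × CyclicGrp (p ^ (n - 1))) ∨
          Nonempty (G ≃* ModularPGroup p n))) ∧
    -- `p = 2`, `n = 3`
    (p = 2 → n = 3 →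
      IsNonCyclicOfOrder 2 3 (QuaternionGroup 2) ∧
      alphaRatio (CyclicGrp (2 ^ 3)) < alphaRatio (QuaternionGroup 2) ∧
      ∀ (G : Type u) [Group G], IsNonCyclicOfOrder 2 3 G →
        alphaRatio (QuaternionGroup 2) ≤ alphaRatio G ∧
        (alphaRatio G = alphaRatio (QuaternionGroup 2) ↔
          Nonempty (G ≃* QuaternionGroup 2))) ∧
    -- `p = 2`, `n = 4`
    (p = 2 → n = 4 →
      IsNonCyclicOfOrder 2 4 (CyclicGrp 2 × CyclicGrp 8) ∧
      IsNonCyclicOfOrder 2 4 (ModularPGroup 2 4) ∧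
      IsNonCyclicOfOrder 2 4 (QuaternionGroup 4) ∧
      alphaRatio (CyclicGrp 2 × CyclicGrp 8) = alphaRatio (ModularPGroup 2 4) ∧
      alphaRatio (ModularPGroup 2 4) = alphaRatio (QuaternionGroup 4) ∧
      alphaRatio (CyclicGrp (2 ^ 4)) < alphaRatio (CyclicGrp 2 × CyclicGrp 8) ∧
      ∀ (G : Type u) [Group G], IsNonCyclicOfOrder 2 4 G →
        alphaRatio (CyclicGrp 2 × CyclicGrp 8) ≤ alphaRatio G ∧
        (alphaRatio G = alphaRatio (CyclicGrp 2 × CyclicGrp 8) ↔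
          Nonempty (G ≃* CyclicGrp 2 × CyclicGrp 8) ∨
          Nonempty (G ≃* ModularPGroup 2 4) ∨
          Nonempty (G ≃* QuaternionGroup 4))) ∧
    -- `p = 2`, `n ≥ 5`
    (p = 2 → 5 ≤ n →
      IsNonCyclicOfOrder 2 n (CyclicGrp 2 × CyclicGrp (2 ^ (n - 1))) ∧
      IsNonCyclicOfOrder 2 n (ModularPGroup 2 n) ∧
      alphaRatio (CyclicGrp 2 × CyclicGrp (2 ^ (n - 1))) = alphaRatio (ModularPGroup 2 n) ∧
      alphaRatio (CyclicGrp (2 ^ n)) < alphaRatio (CyclicGrp 2 × CyclicGrp (2 ^ (n - 1))) ∧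
      ∀ (G : Type u) [Group G], IsNonCyclicOfOrder 2 n G →
        alphaRatio (CyclicGrp 2 × CyclicGrp (2 ^ (n - 1))) ≤ alphaRatio G ∧
        (alphaRatio G = alphaRatio (CyclicGrp 2 × CyclicGrp (2 ^ (n - 1))) ↔
          Nonempty (G ≃* CyclicGrp 2 × CyclicGrp (2 ^ (n - 1))) ∨
          Nonempty (G ≃* ModularPGroup 2 n))) := by
  obtain ⟨m, rfl⟩ : ∃ m, n = m + 1 := ⟨n - 1, by omega⟩
  have hm : 2 ≤ m := by omega
  refine ⟨fun h2 => ?_, ?_, ?_, ?_⟩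
  · have hm' : p = 2 → 3 ≤ m := fun h => (h2 h).elim
    obtain ⟨h1, h3, h4, h5⟩ := minimum_points hp hm hm'
    refine ⟨h1, h3, h4, h5, fun G _ hG => ?_⟩
    obtain ⟨hle, himp⟩ := alphaRatio_prod_le hp hm hm' hG
    refine ⟨hle, fun heq => ?_, ?_⟩
    · rcases himp heq with h | h | ⟨h, -⟩
      · exact .inl h
      · exact .inr h
      · exact (h2 h).elim
    · rintro (⟨⟨e⟩⟩ | ⟨⟨e⟩⟩)
      · exact alphaRatio_congr e
      · exact (alphaRatio_congr e).trans h4.symm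
  · rintro rfl hm3
    have hQ : IsNonCyclicOfOrder 2 3 (QuaternionGroup 2) :=
      QuaternionGroup.isNonCyclicOfOrder (m := 2) le_rfl
    have hQc : Nat.card (cyclicSubgroups (QuaternionGroup 2)) = 5 :=
      QuaternionGroup.card_cyclicSubgroups (m := 2) two_ne_zero
    have hfQ := finite_of_card_eq_prime_pow hp hQ.1
    have hfC := finite_of_card_eq_prime_pow hp (CyclicGrp.card_eq (2 ^ 3))
    refine ⟨hQ, ?_, fun G _ hG => ?_⟩
    · rw [alphaRatio_lt_alphaRatio_iff (by rw [CyclicGrp.card_eq, hQ.1]), hQc,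
        CyclicGrp.card_cyclicSubgroups hp]
      omega
    · obtain ⟨hle, himp⟩ := card_cyclicSubgroups_lower_bound_eight hG
      have hfG := finite_of_card_eq_prime_pow hp hG.1
      refine ⟨?_, fun heq => himp ?_, fun ⟨e⟩ => alphaRatio_congr e⟩
      · rwa [alphaRatio_le_alphaRatio_iff (by rw [hQ.1, hG.1]), hQc]
      · rwa [alphaRatio_eq_alphaRatio_iff (by rw [hQ.1, hG.1]), hQc] at heq
  · rintro rfl hm3
    obtain rfl : m = 3 := by omega
    obtain ⟨h1, h3, h4, h5⟩ := minimum_points hp hm fun _ => le_rfl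
    refine ⟨h1, h3, QuaternionGroup.isNonCyclicOfOrder (m := 3) (by omega), h4,
      alphaRatio_quaternionGroup_four, h5, fun G _ hG => ?_⟩
    obtain ⟨hle, himp⟩ := alphaRatio_prod_le hp hm (fun _ => le_rfl) hG
    refine ⟨hle, fun heq => ?_, ?_⟩
    · rcases himp heq with h | h | ⟨-, -, h⟩
      · exact .inl h
      · exact .inr (.inl h)
      · exact .inr (.inr h)
    · rintro (⟨⟨e⟩⟩ | ⟨⟨e⟩⟩ | ⟨⟨e⟩⟩)
      · exact alphaRatio_congr e
      · exact (alphaRatio_congr e).trans h4.symm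
      · exact (alphaRatio_congr e).trans (h4.trans alphaRatio_quaternionGroup_four).symm
  · rintro rfl hm5
    have hm' : 2 = 2 → 3 ≤ m := fun _ => by omega
    obtain ⟨h1, h3, h4, h5⟩ := minimum_points hp hm hm'
    refine ⟨h1, h3, h4, h5, fun G _ hG => ?_⟩
    obtain ⟨hle, himp⟩ := alphaRatio_prod_le hp hm hm' hG
    refine ⟨hle, fun heq => ?_, ?_⟩
    · rcases himp heq with h | h | ⟨-, h, -⟩
      · exact .inl h
      · exact .inr h
      · omega
    · rintro (⟨⟨e⟩⟩ | ⟨⟨e⟩⟩)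
      · exact alphaRatio_congr e
      · exact (alphaRatio_congr e).trans h4.symm
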